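/- A barrier for a set $U\subseteq\mathbb R^2$ is a set $B\subseteq\mathbb R^2$ that intersects every straight line that intersects $U$. A set $B\subseteq\mathbb R^2$ is rectifiable if it is a union of countably many curves, pairwise disjoint except at endpoints, each of finite length, such that the sum of these lengths converges; this sum is the length of $B$. Theorem. Let $U\subseteq\mathbb R^2$ be a closed convex set with nonempty interior whose perimeter (the length of its boundary) is finite and equal to $2p$, and suppose that $U$ is not a triangle. Then there is $\varepsilon>0$, which may depend on $U$, such that every rectifiable barrier $B$ for $U$ has length at least $p+\varepsilon$. -/

import Mathlib

open scoped ENNReal NNReal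

namespace OpaqueSet

/-- The Euclidean plane. -/
abbrev Plane : Type := EuclideanSpace ℝ (Fin 2)

/-- A (compact, parametrized) curve in the plane. -/
abbrev Curve : Type := C(unitInterval, Plane)

/-- The length of a curve: the supremum of the lengths of its inscribed polygonal lines. -/
noncomputable def Curve.length (γ : Curve) : ℝ≥0∞ := eVariationOn γ Set.univ

/-- The two endpoints of a curve. -/
def Curve.endpoints (γ : Curve) : Set Plane := {γ 0, γ 1}

/-- `B` is a barrier (opaque set) for `U`: every line that intersects `U` intersects `B`. -/
def IsBarrier (B U : Set Plane) : Prop :=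
  ∀ l : AffineSubspace ℝ Plane, Module.finrank ℝ l.direction = 1 →
    ((l : Set Plane) ∩ U).Nonempty → ((l : Set Plane) ∩ B).Nonempty

/-- `B` is rectifiable with length `L`: it is a union of countably many curves, pairwise disjoint
except at endpoints, whose lengths have the finite sum `L`. -/
def IsRectifiableWithLength (B : Set Plane) (L : ℝ≥0) : Prop :=
  ∃ (ι : Type) (_ : Countable ι) (γ : ι → Curve),
    B = ⋃ i, Set.range (γ i) ∧
    (∀ i j, i ≠ j →
      Set.range (γ i) ∩ Set.range (γ j) ⊆ Curve.endpoints (γ i) ∪ Curve.endpoints (γ j)) ∧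
    ∑' i, Curve.length (γ i) = L

/-- The perimeter of a planar set: the length (one-dimensional Hausdorff measure, which gives each
segment its Euclidean length) of its boundary. -/
noncomputable def perimeter (U : Set Plane) : ℝ≥0∞ :=
  MeasureTheory.Measure.hausdorffMeasure 1 (frontier U)

/-- `U` is a (filled, non-degenerate) triangle. -/
def IsTriangle (U : Set Plane) : Prop :=
  ∃ T : Affine.Triangle ℝ Plane, U = convexHull ℝ (Set.range T.points)

end OpaqueSet

/-! In every direction the projection of a barrier contains the projection of `U`. Integrated over
all angles, a segment counts in proportion to its length (`integral_abs_pr`), and the widths of `U`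
give at least its perimeter (`integral_width`, `perimeter_le_integral_supp`). This is the classical
bound p. A gain over p comes from waste: the `defect` compares the total length of the shadows with
the width of `U`, and `exists_gap` bounds the waste below by a constant depending only on `U`.

A rectifiable set is first replaced by finitely many segments of one common short length, which
leave at most measure τ uncovered in each direction (`exists_equal_segments`). Waste then arises in
two ways. A segment far from `U` casts its shadow outside that of `U` for a whole range of angles
(`card_far_mul_le`). And shadows may overlap.

A set that is not a triangle has four extreme points, no three of them collinear. A thin slice of
`U` at each of them has to be covered, so unless far segments abound, a definite length of segments
clusters near each (`slice_le_card`). Most segments of a cluster can be nearly aligned with at most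
one of the other three points, so among four points some pair has neither cluster mostly aligned
with the line joining them (`exists_transversal_pair`); three points could be aligned cyclically,
which is why triangles escape. When the angle turns past the direction in which such a pair projects
to one point, the shadows of the two clusters pass through each other. Having definite total length
and bounded speed, they overlap by a definite amount (`exists_overlap_of_crossing`,
`le_integral_defect_of_crossing`).

An unbounded `U` has no rectifiable barrier at all. -/

namespace OpaqueSet
open MeasureTheory Set

/-! ### Order statistics and queues -/

/-- The `i`-th smallest entry of a tuple (the largest one if `i` exceeds the length). -/
noncomputable def orderStat {m : ℕ} (f : Fin (m + 1) → ℝ) (i : ℕ) : ℝ :=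
  f (Tuple.sort f ⟨min i m, by omega⟩)

theorem orderStat_mono {m : ℕ} (f : Fin (m + 1) → ℝ) : Monotone (orderStat f) := fun i j hij =>
  Tuple.monotone_sort f (Fin.mk_le_mk.2 (by omega))

theorem exists_orderStat_eq {m : ℕ} (f : Fin (m + 1) → ℝ) (k : Fin (m + 1)) :
    ∃ i < m + 1, orderStat f i = f k := by
  refine ⟨(Tuple.sort f).symm k, ((Tuple.sort f).symm k).2, ?_⟩
  have : (⟨min ((Tuple.sort f).symm k : ℕ) m, by omega⟩ : Fin (m + 1)) = (Tuple.sort f).symm k := by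
    ext; simp; omega
  rw [orderStat, this]; simp

theorem card_sort_le {m : ℕ} (f : Fin (m + 1) → ℝ) (y : ℝ) :
    (Finset.univ.filter fun i => (f ∘ Tuple.sort f) i ≤ y).card =
      (Finset.univ.filter fun i => f i ≤ y).card := by
  refine Finset.card_bij (fun i _ => Tuple.sort f i) (by simp) (by simp) ?_
  intro b hb
  exact ⟨(Tuple.sort f).symm b, by simpa using hb, by simp⟩

/-- The `i`-th smallest entry is at most `y` exactly when more than `i` entries are, and every entry
of `g` below `y` gives one of `f` below `y + c`. -/
theorem orderStat_le_add {m : ℕ} {f g : Fin (m + 1) → ℝ} {c : ℝ} (h : ∀ k, f k ≤ g k + c) (i : ℕ) :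
    orderStat f i ≤ orderStat g i + c := by
  have h1 := (Tuple.lt_card_le_iff_apply_le_of_monotone (j := ⟨min i m, by omega⟩)
    (a := orderStat g i) (Tuple.monotone_sort g)).2 le_rfl
  refine (Tuple.lt_card_le_iff_apply_le_of_monotone (j := ⟨min i m, by omega⟩)
    (a := orderStat g i + c) (Tuple.monotone_sort f)).1 (h1.trans_le ?_)
  rw [card_sort_le, card_sort_le]
  exact Finset.card_le_card fun k hk => by
    simp only [Finset.mem_filter, Finset.mem_univ, true_and] at hk ⊢
    exact (h k).trans (by linarith)

/-- Starting times of unit service `w` in a first-come-first-served queue with arrivals `x`. -/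
noncomputable def queue (w : ℝ) (x : ℕ → ℝ) : ℕ → ℝ
  | 0 => x 0
  | i + 1 => max (x (i + 1)) (queue w x i + w)

theorem queue_le_add {w c : ℝ} {x y : ℕ → ℝ} (h : ∀ i, x i ≤ y i + c) (i : ℕ) :
    queue w x i ≤ queue w y i + c := by
  induction i with
  | zero => exact h 0
  | succ i ih =>
    rw [queue, queue, ← max_add_add_right]
    exact max_le_max (h _) (by linarith)

theorem le_queue (w : ℝ) (x : ℕ → ℝ) (i : ℕ) : x i ≤ queue w x i := by
  cases i with
  | zero => exact le_rfl
  | succ i => exact le_max_left _ _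

theorem queue_add_le (w : ℝ) (x : ℕ → ℝ) (i : ℕ) : queue w x i + w ≤ queue w x (i + 1) :=
  le_max_right _ _

theorem queue_le {w c : ℝ} (hw : 0 ≤ w) {x : ℕ → ℝ} (h : ∀ i, x i ≤ c) (i : ℕ) :
    queue w x i ≤ c + i * w := by
  induction i with
  | zero => simpa [queue] using h 0
  | succ i ih =>
    rw [queue]
    refine max_le ((h _).trans ?_) ?_
    · have : 0 ≤ ((i + 1 : ℕ) : ℝ) * w := by positivity
      linarith
    · push_cast; linarith

theorem queue_add_le_of_lt {w : ℝ} (hw : 0 ≤ w) (x : ℕ → ℝ) {i j : ℕ} (h : i < j) :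
    queue w x i + w ≤ queue w x j := by
  induction j, h using Nat.le_induction with
  | base => exact queue_add_le w x i
  | succ j _ ih => linarith [queue_add_le w x j]

/-- A server is never idle while a customer waits: if service `i + 1` starts after its arrival, it
starts exactly when service `i` ends. -/
theorem Ico_subset_iUnion_queue {w : ℝ} {x : ℕ → ℝ} (hx : Monotone x) (i : ℕ) :
    Ico (x i) (queue w x i + w) ⊆ ⋃ j ∈ Finset.range (i + 1), Ico (queue w x j) (queue w x j + w) := by
  induction i with
  | zero => simp [queue]
  | succ i ih =>
    intro t ht
    rcases le_or_gt (queue w x (i + 1)) t with h | h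
    · exact mem_biUnion (Finset.mem_coe.2 (Finset.self_mem_range_succ (i + 1))) ⟨h, ht.2⟩
    · have h2 : t < queue w x i + w := by
        rcases max_choice (x (i + 1)) (queue w x i + w) with h' | h'
        · rw [queue, h'] at h; exact absurd ht.1 (not_le.2 h)
        · rwa [queue, h'] at h
      have := ih ⟨(hx (Nat.le_succ i)).trans ht.1, h2⟩
      refine biUnion_subset_biUnion_left ?_ this
      intro a ha
      simp only [Finset.coe_range, mem_Iio] at ha ⊢
      omega

/-- The ordered and separated version of a tuple of intervals of length `w`. -/
noncomputable def spread {m : ℕ} (w : ℝ) (f : Fin (m + 1) → ℝ) : ℕ → ℝ := queue w (orderStat f)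

theorem iUnion_Ico_subset_spread {m : ℕ} (w : ℝ) (f : Fin (m + 1) → ℝ) :
    (⋃ k, Ico (f k) (f k + w)) ⊆
      ⋃ j ∈ Finset.range (m + 1), Ico (spread w f j) (spread w f j + w) := by
  refine iUnion_subset fun k => ?_
  obtain ⟨i, hi, hk⟩ := exists_orderStat_eq f k
  refine subset_trans ?_ ((Ico_subset_iUnion_queue (w := w) (orderStat_mono f) i).trans
    (biUnion_subset_biUnion_left ?_))
  · rw [← hk]
    exact Ico_subset_Ico le_rfl (by linarith [le_queue w (orderStat f) i])
  · intro a ha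
    simp only [Finset.coe_range, mem_Iio] at ha ⊢
    omega

/-- Sorting and queueing are both 1-Lipschitz in the sup norm. Intervals moving at bounded speed can
therefore be made disjoint without increasing the speed bound. -/
theorem abs_spread_sub_le {m : ℕ} {w c : ℝ} {f g : Fin (m + 1) → ℝ} (h : ∀ k, |f k - g k| ≤ c)
    (i : ℕ) : |spread w f i - spread w g i| ≤ c := by
  rw [abs_sub_le_iff]
  constructor
  · have := queue_le_add (w := w) (orderStat_le_add fun k =>
      (by linarith [(abs_sub_le_iff.1 (h k)).1] : f k ≤ g k + c)) i
    simp only [spread]; linarith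
  · have := queue_le_add (w := w) (orderStat_le_add fun k =>
      (by linarith [(abs_sub_le_iff.1 (h k)).2] : g k ≤ f k + c)) i
    simp only [spread]; linarith

theorem spread_le {m : ℕ} {w c : ℝ} (hw : 0 ≤ w) {f : Fin (m + 1) → ℝ} (h : ∀ k, f k ≤ c) {i : ℕ}
    (hi : i < m + 1) : spread w f i ≤ c + m * w := by
  have h1 := queue_le hw (x := orderStat f) (fun i => h _) i
  have h2 : (i : ℝ) * w ≤ m * w := by
    gcongr; exact_mod_cast Nat.lt_succ_iff.1 hi
  exact h1.trans (by linarith)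

theorem le_spread {m : ℕ} {w c : ℝ} {f : Fin (m + 1) → ℝ} (h : ∀ k, c ≤ f k) (i : ℕ) :
    c ≤ spread w f i :=
  (h _).trans (le_queue w (orderStat f) i)

theorem pairwise_disjoint_spread {m : ℕ} {w : ℝ} (hw : 0 ≤ w) (f : Fin (m + 1) → ℝ) :
    Pairwise (Function.onFun Disjoint fun j => Ico (spread w f j) (spread w f j + w)) := by
  have key : ∀ i j, i < j → Disjoint (Ico (spread w f i) (spread w f i + w))
      (Ico (spread w f j) (spread w f j + w)) := fun i j h => by
    rw [Set.disjoint_left]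
    intro t ht ht'
    have := queue_add_le_of_lt hw (orderStat f) h
    simp only [spread] at ht ht'
    linarith [ht.2, ht'.1]
  intro i j hij
  rcases lt_or_gt_of_ne hij with h | h
  · exact key i j h
  · exact (key j i h).symm

theorem volume_real_inter_Ico (x y w : ℝ) :
    volume.real (Ico x (x + w) ∩ Ico y (y + w)) = max 0 (w - |x - y|) := by
  rw [Ico_inter_Ico, Measure.real, Real.volume_Ico, ENNReal.toReal_ofReal', max_comm]
  congr 1
  rcases le_total x y with h | h
  · rw [abs_of_nonpos (by linarith), sup_of_le_right h, inf_of_le_left (by linarith)]; ring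
  · rw [abs_of_nonneg (by linarith), sup_of_le_left h, inf_of_le_right (by linarith)]; ring

theorem volume_real_iUnion_spread {m : ℕ} {w : ℝ} (hw : 0 ≤ w) (f : Fin (m + 1) → ℝ) :
    volume.real (⋃ j ∈ Finset.range (m + 1), Ico (spread w f j) (spread w f j + w)) =
      (m + 1) * w := by
  rw [measureReal_biUnion_finset (fun i _ j _ h => pairwise_disjoint_spread hw f h)
    (fun _ _ => measurableSet_Ico) (fun _ _ => by simp)]
  simp [hw]

/-- Spreading only enlarges the union, so inclusion–exclusion for the spread families suffices. Each
of these is disjoint, hence the pairwise intersections partition the common part. -/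
theorem sum_overlap_le {m : ℕ} {w : ℝ} (hw : 0 ≤ w) (f g : Fin (m + 1) → ℝ) :
    ∑ i ∈ Finset.range (m + 1), ∑ j ∈ Finset.range (m + 1),
        max 0 (w - |spread w f i - spread w g j|) ≤
      2 * ((m + 1) * w) - volume.real
        ((⋃ k, Ico (f k) (f k + w)) ∪ ⋃ k, Ico (g k) (g k + w)) := by
  set A := ⋃ j ∈ Finset.range (m + 1), Ico (spread w f j) (spread w f j + w) with hA
  set B := ⋃ j ∈ Finset.range (m + 1), Ico (spread w g j) (spread w g j + w) with hB
  have hAf : volume A ≠ ∞ := (measure_biUnion_lt_top (Finset.finite_toSet _) fun _ _ => by simp).ne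
  have hBf : volume B ≠ ∞ := (measure_biUnion_lt_top (Finset.finite_toSet _) fun _ _ => by simp).ne
  have hBm : MeasurableSet B := Finset.measurableSet_biUnion _ fun _ _ => measurableSet_Ico
  have h1 := measureReal_union_add_inter (μ := volume) (s := A) hBm hAf hBf
  rw [volume_real_iUnion_spread hw, volume_real_iUnion_spread hw] at h1
  have h2 : volume.real ((⋃ k, Ico (f k) (f k + w)) ∪ ⋃ k, Ico (g k) (g k + w)) ≤
      volume.real (A ∪ B) :=
    measureReal_mono (union_subset_union (iUnion_Ico_subset_spread w f)
      (iUnion_Ico_subset_spread w g)) (measure_union_lt_top hAf.lt_top hBf.lt_top).ne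
  have h3 : volume.real (A ∩ B) = ∑ i ∈ Finset.range (m + 1), ∑ j ∈ Finset.range (m + 1),
        max 0 (w - |spread w f i - spread w g j|) := by
    have : A ∩ B = ⋃ p ∈ Finset.range (m + 1) ×ˢ Finset.range (m + 1),
        (Ico (spread w f p.1) (spread w f p.1 + w) ∩ Ico (spread w g p.2) (spread w g p.2 + w)) := by
      ext t
      simp only [hA, hB, mem_inter_iff, mem_iUnion, Finset.mem_product, exists_prop, Prod.exists]
      constructor
      · rintro ⟨⟨i, hi, hi'⟩, j, hj, hj'⟩; exact ⟨i, j, ⟨hi, hj⟩, hi', hj'⟩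
      · rintro ⟨i, j, ⟨hi, hj⟩, hi', hj'⟩; exact ⟨⟨i, hi, hi'⟩, j, hj, hj'⟩
    rw [this, measureReal_biUnion_finset ?_ ?_ ?_, Finset.sum_product]
    · simp_rw [volume_real_inter_Ico]
    · intro p _ q _ hpq
      by_cases h : p.1 = q.1
      · have h' : p.2 ≠ q.2 := fun h' => hpq (Prod.ext h h')
        exact (pairwise_disjoint_spread hw g h').mono inter_subset_right inter_subset_right
      · exact (pairwise_disjoint_spread hw f h).mono inter_subset_left inter_subset_left
    · exact fun _ _ => measurableSet_Ico.inter measurableSet_Ico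
    · exact fun _ _ => (measure_mono inter_subset_left |>.trans_lt (by simp)).ne
  linarith

/-! ### Moving intervals that pass through each other -/

theorem continuous_of_abs_sub_le {f : ℝ → ℝ} {K : ℝ} (h : ∀ a b, |f a - f b| ≤ K * |a - b|) :
    Continuous f :=
  (LipschitzWith.of_dist_le_mul (K := K.toNNReal) fun a b => by
    rw [Real.dist_eq, Real.dist_eq]
    exact (h a b).trans (mul_le_mul_of_nonneg_right (Real.le_coe_toNNReal K)
      (abs_nonneg _))).continuous

theorem le_integral_overlap {d : ℝ → ℝ} {K w a b : ℝ} (hK : 0 < K) (hw : 0 < w) (hab : a ≤ b)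
    (hd : ∀ s t, |d s - d t| ≤ 2 * K * |s - t|) (ha : d a ≤ -w) (hb : w ≤ d b) :
    w ^ 2 / (4 * K) ≤ ∫ s in a..b, max 0 (w - |d s|) := by
  have hc := continuous_of_abs_sub_le hd
  obtain ⟨z, hz, hz0⟩ := intermediate_value_Icc hab hc.continuousOn
    (show (0 : ℝ) ∈ Icc (d a) (d b) from ⟨by linarith, by linarith⟩)
  -- The relative speed is at most `2 * K`, so within time `r` of the meeting time `z` the offset
  -- stays below `w / 2`, and the overlap is at least `w / 2`.
  set r := w / (4 * K) with hr
  have hr0 : 0 < r := by positivity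
  have hKr : 2 * K * r = w / 2 := by rw [hr]; field_simp; norm_num
  have h1 : a ≤ z - r := by
    by_contra! h
    have h2 := hd z a
    rw [hz0, abs_of_nonneg (by linarith), abs_of_nonneg (by linarith [hz.1])] at h2
    nlinarith
  have h2 : z + r ≤ b := by
    by_contra! h
    have h2 := hd b z
    rw [hz0, abs_of_nonneg (by linarith), abs_of_nonneg (by linarith [hz.2])] at h2
    nlinarith
  have hcont : Continuous fun s => max 0 (w - |d s|) := by fun_prop
  calc w ^ 2 / (4 * K) = ∫ s in (z - r)..(z + r), w / 2 := by
        rw [intervalIntegral.integral_const, smul_eq_mul, hr]; field_simp; ring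
    _ ≤ ∫ s in (z - r)..(z + r), max 0 (w - |d s|) := by
        refine intervalIntegral.integral_mono_on (by linarith) (by simp)
          (hcont.intervalIntegrable _ _) fun s hs => le_max_of_le_right ?_
        have h3 := hd s z
        rw [hz0, sub_zero] at h3
        have h4 : |s - z| ≤ r := abs_le.2 ⟨by linarith [hs.1], by linarith [hs.2]⟩
        nlinarith
    _ ≤ ∫ s in a..b, max 0 (w - |d s|) :=
        intervalIntegral.integral_mono_interval h1 (by linarith) h2
          (Filter.Eventually.of_forall fun s => le_max_left _ _) (hcont.intervalIntegrable _ _)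

/-- Two families of equally long intervals that move at bounded speed and pass through each other
overlap substantially. -/
theorem exists_overlap_of_crossing {m : ℕ} (f g : Fin (m + 1) → ℝ → ℝ) {K w a b : ℝ} (hK : 0 < K)
    (hw : 0 < w) (hab : a ≤ b) (hf : ∀ k s t, |f k s - f k t| ≤ K * |s - t|)
    (hg : ∀ k s t, |g k s - g k t| ≤ K * |s - t|)
    (ha : ∀ k l, f k a + (m + 1) * w ≤ g l a) (hb : ∀ k l, g l b + (m + 1) * w ≤ f k b) :
    ∃ G : ℝ → ℝ, Continuous G ∧ (∀ s, 0 ≤ G s) ∧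
      (∀ s, G s ≤ 2 * ((m + 1) * w) - volume.real
        ((⋃ k, Ico (f k s) (f k s + w)) ∪ ⋃ k, Ico (g k s) (g k s + w))) ∧
      ((m + 1) * w) ^ 2 / (4 * K) ≤ ∫ s in a..b, G s := by
  set X : ℕ → ℝ → ℝ := fun i s => spread w (fun k => f k s) i
  set Y : ℕ → ℝ → ℝ := fun i s => spread w (fun k => g k s) i
  have hX : ∀ i s t, |X i s - X i t| ≤ K * |s - t| := fun i s t =>
    abs_spread_sub_le (fun k => hf k s t) i
  have hY : ∀ i s t, |Y i s - Y i t| ≤ K * |s - t| := fun i s t =>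
    abs_spread_sub_le (fun k => hg k s t) i
  have hXc := fun i => continuous_of_abs_sub_le (hX i)
  have hYc := fun i => continuous_of_abs_sub_le (hY i)
  have hpair : ∀ i j, Continuous fun s => max 0 (w - |X i s - Y j s|) := fun i j => by
    have := hXc i; have := hYc j; fun_prop
  refine ⟨fun s => ∑ i ∈ Finset.range (m + 1), ∑ j ∈ Finset.range (m + 1),
      max 0 (w - |X i s - Y j s|), ?_, ?_, ?_, ?_⟩
  · exact continuous_finsetSum _ fun i _ => continuous_finsetSum _ fun j _ => hpair i j
  · exact fun s => Finset.sum_nonneg fun i _ => Finset.sum_nonneg fun j _ => le_max_left _ _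
  · exact fun s => sum_overlap_le hw.le _ _
  · rw [intervalIntegral.integral_finsetSum fun i _ => (continuous_finsetSum _ fun j _ =>
      hpair i j).intervalIntegrable _ _]
    have : ∀ i ∈ Finset.range (m + 1), (m + 1) * (w ^ 2 / (4 * K)) ≤
        ∫ s in a..b, ∑ j ∈ Finset.range (m + 1), max 0 (w - |X i s - Y j s|) := by
      intro i hi
      rw [intervalIntegral.integral_finsetSum fun j _ => (hpair i j).intervalIntegrable _ _]
      refine le_trans (le_of_eq ?_) (Finset.card_nsmul_le_sum (Finset.range (m + 1)) _
        (w ^ 2 / (4 * K)) fun j hj => ?_)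
      · simp
      · refine le_integral_overlap hK hw hab (fun s t => ?_) ?_ ?_
        · have h1 := abs_le.1 (hX i s t); have h2 := abs_le.1 (hY j s t)
          rw [abs_le]; constructor <;> linarith
        -- Queueing delays an interval by at most `m * w`; the initial gap `(m + 1) * w` thus still
        -- leaves a full `w` between the spread intervals.
        · have h1 : X i a ≤ Y j a - (m + 1) * w + m * w :=
            spread_le hw.le (c := Y j a - (m + 1) * w) (fun k => by
              have : f k a + (m + 1) * w ≤ Y j a := le_spread (fun l => ha k l) j
              linarith) (Finset.mem_range.1 hi)
          linarith
        · have h1 : Y j b ≤ X i b - (m + 1) * w + m * w :=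
            spread_le hw.le (c := X i b - (m + 1) * w) (fun k => by
              have : g k b + (m + 1) * w ≤ X i b := le_spread (fun l => hb l k) i
              linarith) (Finset.mem_range.1 hj)
          linarith
    refine le_trans (le_of_eq ?_) (Finset.card_nsmul_le_sum _ _ _ this)
    simp; field_simp

/-! ### Projections onto lines and support functions -/

/-- The coordinate of `z` along the unit vector of angle `α`. -/
noncomputable def pr (α : ℝ) (z : Plane) : ℝ := Real.cos α * z 0 + Real.sin α * z 1

/-- The unit vector of angle `α`. -/
noncomputable def dir (α : ℝ) : Plane := !₂[Real.cos α, Real.sin α]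

@[simp] theorem dir_zero (α : ℝ) : dir α 0 = Real.cos α := rfl
@[simp] theorem dir_one (α : ℝ) : dir α 1 = Real.sin α := rfl

theorem pr_add (α : ℝ) (x y : Plane) : pr α (x + y) = pr α x + pr α y := by
  simp [pr]; ring

theorem pr_sub (α : ℝ) (x y : Plane) : pr α (x - y) = pr α x - pr α y := by
  simp [pr]; ring

theorem pr_smul (α c : ℝ) (x : Plane) : pr α (c • x) = c * pr α x := by
  simp [pr]; ring

theorem pr_neg (α : ℝ) (x : Plane) : pr α (-x) = -pr α x := by
  simp [pr]; ring

theorem norm_sq_eq (z : Plane) : ‖z‖ ^ 2 = z 0 ^ 2 + z 1 ^ 2 := by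
  rw [EuclideanSpace.norm_sq_eq, Fin.sum_univ_two]; simp

theorem continuous_pr_left (z : Plane) : Continuous fun α => pr α z := by
  unfold pr; fun_prop

theorem continuous_pr_right (α : ℝ) : Continuous (pr α) := by
  unfold pr; fun_prop

theorem exists_eq_smul_dir (v : Plane) : ∃ φ ∈ Ioc (-Real.pi) Real.pi, v = ‖v‖ • dir φ := by
  set z : ℂ := ⟨v 0, v 1⟩
  have hz : ‖z‖ = ‖v‖ := by
    have : ‖z‖ ^ 2 = ‖v‖ ^ 2 := by
      rw [norm_sq_eq, Complex.sq_norm, Complex.normSq_apply]; ring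
    exact (sq_eq_sq₀ (norm_nonneg _) (norm_nonneg _)).1 this
  refine ⟨z.arg, Complex.arg_mem_Ioc z, ?_⟩
  ext i
  fin_cases i
  · simpa [hz] using (Complex.norm_mul_cos_arg z).symm
  · simpa [hz] using (Complex.norm_mul_sin_arg z).symm

theorem pr_dir (α β : ℝ) : pr α (dir β) = Real.cos (α - β) := by
  rw [pr, dir_zero, dir_one, Real.cos_sub]

theorem norm_dir (α : ℝ) : ‖dir α‖ = 1 := by
  have h : ‖dir α‖ ^ 2 = 1 := by rw [norm_sq_eq]; simp
  nlinarith [norm_nonneg (dir α)]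

theorem abs_pr_le (α : ℝ) (z : Plane) : |pr α z| ≤ ‖z‖ := by
  obtain ⟨φ, -, h⟩ := exists_eq_smul_dir z
  rw [h, pr_smul, pr_dir, abs_mul, norm_smul, norm_dir, mul_one, norm_norm, abs_norm]
  exact mul_le_of_le_one_right (norm_nonneg _) (Real.abs_cos_le_one _)

theorem abs_pr_sub_pr_le (α β : ℝ) (z : Plane) : |pr α z - pr β z| ≤ ‖z‖ * |α - β| := by
  obtain ⟨φ, -, h⟩ := exists_eq_smul_dir z
  have : |Real.cos (α - φ) - Real.cos (β - φ)| ≤ |α - β| := by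
    have := Real.abs_cos_sub_cos_le (α - φ) (β - φ)
    simpa using this
  rw [h, pr_smul, pr_smul, pr_dir, pr_dir, ← mul_sub, abs_mul, norm_smul, norm_dir, mul_one,
    norm_norm, abs_norm]
  gcongr

theorem pr_add_pi (α : ℝ) (z : Plane) : pr (α + Real.pi) z = -pr α z := by
  simp [pr]; ring

theorem pr_add_two_pi (α : ℝ) (z : Plane) : pr (α + 2 * Real.pi) z = pr α z := by
  simp [pr]

theorem integral_abs_cos_pi (t : ℝ) : ∫ α in t..(t + Real.pi), |Real.cos α| = 2 := by
  have hp : Function.Periodic (fun α => |Real.cos α|) Real.pi := fun α => by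
    simp [Real.cos_add_pi]
  rw [hp.intervalIntegral_add_eq t (-(Real.pi / 2)),
    show -(Real.pi / 2) + Real.pi = Real.pi / 2 by ring]
  rw [intervalIntegral.integral_congr (g := Real.cos), integral_cos]
  · norm_num
  · intro α hα
    rw [uIcc_of_le (by linarith [Real.pi_pos])] at hα
    exact abs_of_nonneg (Real.cos_nonneg_of_mem_Icc hα)

/-- Two full turns are used so that the angular windows needed later, centred in a single turn, fit
inside without wrapping around. -/
theorem integral_abs_pr (v : Plane) :
    ∫ α in (-(2 * Real.pi))..(2 * Real.pi), |pr α v| = 8 * ‖v‖ := by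
  obtain ⟨φ, -, h⟩ := exists_eq_smul_dir v
  have h1 : ∀ α, |pr α v| = ‖v‖ * |Real.cos (α - φ)| := fun α => by
    conv_lhs => rw [h, pr_smul, pr_dir, abs_mul, abs_norm]
  simp_rw [h1]
  rw [intervalIntegral.integral_const_mul,
    intervalIntegral.integral_comp_sub_right (fun α => |Real.cos α|) φ]
  have hi : ∀ a b, IntervalIntegrable (fun α => |Real.cos α|) volume a b := fun a b =>
    (by fun_prop : Continuous fun α => |Real.cos α|).intervalIntegrable a b
  set t := -(2 * Real.pi) - φ
  rw [show 2 * Real.pi - φ = t + Real.pi + Real.pi + Real.pi + Real.pi by simp only [t]; ring,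
    ← intervalIntegral.integral_add_adjacent_intervals (hi t (t + Real.pi + Real.pi + Real.pi))
      (hi _ _), integral_abs_cos_pi,
    ← intervalIntegral.integral_add_adjacent_intervals (hi t (t + Real.pi + Real.pi))
      (hi _ _), integral_abs_cos_pi,
    ← intervalIntegral.integral_add_adjacent_intervals (hi t (t + Real.pi))
      (hi _ _), integral_abs_cos_pi, integral_abs_cos_pi]
  ring

/-- The support function of `U` as a function of the angle. -/
noncomputable def supp (U : Set Plane) (α : ℝ) : ℝ := sSup (pr α '' U)

/-- The width of `U` in the direction `α`. -/
noncomputable def width (U : Set Plane) (α : ℝ) : ℝ := supp U α + supp U (α + Real.pi)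

section Support
variable {U : Set Plane}

theorem pr_le_supp (hU : IsCompact U) (α : ℝ) {u : Plane} (hu : u ∈ U) : pr α u ≤ supp U α :=
  le_csSup (hU.image (continuous_pr_right α)).bddAbove (mem_image_of_mem _ hu)

theorem exists_pr_eq_supp (hU : IsCompact U) (hne : U.Nonempty) (α : ℝ) :
    ∃ u ∈ U, pr α u = supp U α :=
  (hU.image (continuous_pr_right α)).sSup_mem (hne.image _)

theorem neg_supp_add_pi_le (hU : IsCompact U) (α : ℝ) {u : Plane} (hu : u ∈ U) :
    -supp U (α + Real.pi) ≤ pr α u := by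
  have := pr_le_supp hU (α + Real.pi) hu
  rw [pr_add_pi] at this
  linarith

theorem image_pr_eq_Icc (hU : IsCompact U) (hc : Convex ℝ U) (hne : U.Nonempty) (α : ℝ) :
    pr α '' U = Icc (-supp U (α + Real.pi)) (supp U α) := by
  apply Subset.antisymm
  · rintro _ ⟨u, hu, rfl⟩
    exact ⟨neg_supp_add_pi_le hU α hu, pr_le_supp hU α hu⟩
  · obtain ⟨a, ha, ha'⟩ := exists_pr_eq_supp hU hne (α + Real.pi)
    obtain ⟨b, hb, hb'⟩ := exists_pr_eq_supp hU hne α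
    have hp : IsPreconnected (pr α '' U) :=
      hc.isPreconnected.image _ (continuous_pr_right α).continuousOn
    refine hp.Icc_subset ⟨a, ha, ?_⟩ ⟨b, hb, hb'⟩
    rw [← ha', pr_add_pi, neg_neg]

theorem neg_supp_add_pi_le_supp (hU : IsCompact U) (hne : U.Nonempty) (α : ℝ) :
    -supp U (α + Real.pi) ≤ supp U α := by
  obtain ⟨u, hu⟩ := hne
  exact (neg_supp_add_pi_le hU α hu).trans (pr_le_supp hU α hu)

theorem volume_real_image_pr (hU : IsCompact U) (hc : Convex ℝ U) (hne : U.Nonempty) (α : ℝ) :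
    volume.real (pr α '' U) = width U α := by
  rw [image_pr_eq_Icc hU hc hne, Real.volume_real_Icc_of_le (neg_supp_add_pi_le_supp hU hne α),
    width]
  ring

theorem continuous_supp (hU : IsCompact U) (hne : U.Nonempty) : Continuous (supp U) := by
  obtain ⟨R, hR⟩ := hU.isBounded.exists_norm_le
  have key : ∀ α β, supp U α - supp U β ≤ R * |α - β| := fun α β => by
    obtain ⟨u, hu, h⟩ := exists_pr_eq_supp hU hne α
    have h1 := pr_le_supp hU β hu
    have h2 := (abs_le.1 (abs_pr_sub_pr_le α β u)).2
    have h3 := mul_le_mul_of_nonneg_right (hR u hu) (abs_nonneg (α - β))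
    linarith
  refine continuous_of_abs_sub_le (K := R) fun α β => abs_le.2 ⟨?_, key α β⟩
  have := key β α
  rw [abs_sub_comm] at this
  linarith

theorem continuous_width (hU : IsCompact U) (hne : U.Nonempty) : Continuous (width U) := by
  have := continuous_supp hU hne
  unfold width
  fun_prop

theorem supp_periodic (U : Set Plane) : Function.Periodic (supp U) (2 * Real.pi) := fun α => by
  simp only [supp]
  congr 1
  exact image_congr fun z _ => pr_add_two_pi α z

theorem integral_width (hU : IsCompact U) (hne : U.Nonempty) :
    ∫ α in (-(2 * Real.pi))..(2 * Real.pi), width U α =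
      4 * ∫ α in (0 : ℝ)..(2 * Real.pi), supp U α := by
  have hc := continuous_supp hU hne
  have hper : ∀ t, ∫ α in t..(t + 2 * Real.pi), supp U α =
      ∫ α in (0 : ℝ)..(2 * Real.pi), supp U α := fun t => by
    simpa using (supp_periodic U).intervalIntegral_add_eq t 0
  have h2 : ∀ t, ∫ α in t..(t + 4 * Real.pi), supp U α =
      2 * ∫ α in (0 : ℝ)..(2 * Real.pi), supp U α := fun t => by
    rw [show t + 4 * Real.pi = t + 2 * Real.pi + 2 * Real.pi by ring,
      ← intervalIntegral.integral_add_adjacent_intervals (hc.intervalIntegrable t (t + 2 * Real.pi))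
      (hc.intervalIntegrable _ _), hper, hper]
    ring
  simp only [width]
  rw [intervalIntegral.integral_add (hc.intervalIntegrable _ _)
    ((by fun_prop : Continuous fun α => supp U (α + Real.pi)).intervalIntegrable _ _),
    intervalIntegral.integral_comp_add_right]
  have h3 := h2 (-(2 * Real.pi))
  have h4 := h2 (-(2 * Real.pi) + Real.pi)
  rw [show -(2 * Real.pi) + 4 * Real.pi = 2 * Real.pi by ring] at h3
  rw [show -(2 * Real.pi) + Real.pi + 4 * Real.pi = 2 * Real.pi + Real.pi by ring] at h4
  rw [h3, h4]; ring

end Support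

/-! ### Waste of a finite family of segments -/

/-- Whatever is added to the sets `A k` to obtain all the `I i` raises the measure of the union by
no more than it raises the sum of the measures. Overlap found among parts of some shadows is
therefore overlap of the whole family. -/
theorem sum_sub_measureReal_iUnion_le {ι κ : Type*} [Fintype ι] [Fintype κ] {I : ι → Set ℝ}
    {A : κ → Set ℝ} (hI : ∀ i, volume (I i) ≠ ∞) (hA : ∀ k, MeasurableSet (A k))
    {r : κ → ι} (hr : Function.Injective r) (hAI : ∀ k, A k ⊆ I (r k)) :
    ∑ k, volume.real (A k) - volume.real (⋃ k, A k) ≤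
      ∑ i, volume.real (I i) - volume.real (⋃ i, I i) := by
  classical
  have hsub : (⋃ i, I i) ⊆ (⋃ k, A k) ∪ ((⋃ k, I (r k) \ A k) ∪
      ⋃ i ∈ (Finset.univ.image r)ᶜ, I i) := by
    refine iUnion_subset fun i t ht => ?_
    by_cases hi : i ∈ Finset.univ.image r
    · obtain ⟨k, -, rfl⟩ := Finset.mem_image.1 hi
      by_cases hk : t ∈ A k
      · exact Or.inl (mem_iUnion.2 ⟨k, hk⟩)
      · exact Or.inr (Or.inl (mem_iUnion.2 ⟨k, ht, hk⟩))
    · exact Or.inr (Or.inr (mem_biUnion (Finset.mem_coe.2 (Finset.mem_compl.2 hi)) ht))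
  have hAf : ∀ k, volume (A k) ≠ ∞ := fun k => measure_ne_top_of_subset (hAI k) (hI _)
  have hfin : volume ((⋃ k, A k) ∪ ((⋃ k, I (r k) \ A k) ∪
      ⋃ i ∈ (Finset.univ.image r)ᶜ, I i)) ≠ ∞ := by
    refine (measure_union_lt_top ?_ (measure_union_lt_top ?_ ?_)).ne
    · exact (measure_iUnion_fintype_le _ _).trans_lt
        (ENNReal.sum_lt_top.2 fun k _ => (hAf k).lt_top)
    · exact (measure_iUnion_fintype_le _ _).trans_lt
        (ENNReal.sum_lt_top.2 fun k _ => (measure_ne_top_of_subset sdiff_subset (hI _)).lt_top)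
    · exact (measure_biUnion_finset_le _ _).trans_lt
        (ENNReal.sum_lt_top.2 fun k _ => (hI _).lt_top)
  have h1 := measureReal_mono hsub hfin
  have h2 := h1.trans ((measureReal_union_le _ _).trans
    (add_le_add le_rfl ((measureReal_union_le _ _).trans
      (add_le_add (measureReal_iUnion_fintype_le _) (measureReal_biUnion_finset_le _ _)))))
  have h3 : ∀ k, volume.real (I (r k) \ A k) = volume.real (I (r k)) - volume.real (A k) :=
    fun k => measureReal_sdiff (hAI k) (hA k) (hI _)
  simp only [h3, Finset.sum_sub_distrib] at h2
  have h4 := Finset.sum_add_sum_compl (Finset.univ.image r) fun i => volume.real (I i)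
  rw [Finset.sum_image fun x _ y _ h => hr h] at h4
  linarith

/-- The parts of the `I i` inside `V` cover it up to `τ`, so they use up at least `volume.real V -
τ` of the total. -/
theorem sum_measureReal_diff_le {ι : Type*} [Fintype ι] {I : ι → Set ℝ} {V : Set ℝ} {τ : ℝ}
    (hV : MeasurableSet V) (hI : ∀ i, volume (I i) ≠ ∞) (hVf : volume V ≠ ∞)
    (hτ : volume.real (V \ ⋃ i, I i) ≤ τ) :
    ∑ i, volume.real (I i \ V) ≤ ∑ i, volume.real (I i) - volume.real V + τ := by
  have hsub : V ⊆ (V \ ⋃ i, I i) ∪ ⋃ i, I i ∩ V := by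
    intro t ht
    by_cases h : t ∈ ⋃ i, I i
    · obtain ⟨i, hi⟩ := mem_iUnion.1 h
      exact Or.inr (mem_iUnion.2 ⟨i, hi, ht⟩)
    · exact Or.inl ⟨ht, h⟩
  have hfin : volume ((V \ ⋃ i, I i) ∪ ⋃ i, I i ∩ V) ≠ ∞ :=
    measure_ne_top_of_subset (union_subset sdiff_subset (iUnion_subset fun i => inter_subset_right))
      hVf
  have h1 := (measureReal_mono hsub hfin).trans ((measureReal_union_le _ _).trans
    (add_le_add le_rfl (measureReal_iUnion_fintype_le _)))
  have h2 : ∀ i, volume.real (I i ∩ V) + volume.real (I i \ V) = volume.real (I i) := fun i =>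
    measureReal_inter_add_sdiff hV (hI i)
  have h3 := Finset.sum_congr rfl fun i (_ : i ∈ Finset.univ) => h2 i
  rw [Finset.sum_add_distrib] at h3
  linarith

/-- The projection of the segment from `a` to `a + v`. -/
def shadow (α : ℝ) (a v : Plane) : Set ℝ := uIcc (pr α a) (pr α a + pr α v)

theorem volume_shadow_ne_top (α : ℝ) (a v : Plane) : volume (shadow α a v) ≠ ∞ := by
  simp [shadow, uIcc]

theorem volume_real_shadow (α : ℝ) (a v : Plane) : volume.real (shadow α a v) = |pr α v| := by
  rw [shadow, Measure.real, Real.volume_interval, ENNReal.toReal_ofReal (abs_nonneg _)]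
  ring_nf

theorem exists_of_mem_shadow {α t : ℝ} {a v : Plane} (h : t ∈ shadow α a v) :
    ∃ s ∈ Icc (0 : ℝ) 1, t = pr α (a + s • v) := by
  rw [shadow, ← segment_eq_uIcc, segment_eq_image'] at h
  obtain ⟨s, hs, rfl⟩ := h
  exact ⟨s, hs, by simp [pr_add, pr_smul]⟩

theorem Ico_subset_shadow {α w : ℝ} {a v : Plane} (h : w ≤ pr α v) :
    Ico (pr α a) (pr α a + w) ⊆ shadow α a v := fun t ht => by
  rw [shadow, mem_uIcc]
  exact Or.inl ⟨ht.1, by linarith [ht.2]⟩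

theorem shadow_swap (α : ℝ) (a v : Plane) : shadow α (a + v) (-v) = shadow α a v := by
  rw [shadow, shadow, pr_add, pr_neg, uIcc_comm]
  ring_nf

/-- How much the projections of a family of segments exceed those of `U`. -/
noncomputable def defect {N : ℕ} (U : Set Plane) (v : Fin N → Plane) (τ α : ℝ) : ℝ :=
  ∑ k, |pr α (v k)| - width U α + τ

section Defect
variable {U : Set Plane} {N : ℕ} {a v : Fin N → Plane} {τ : ℝ}

theorem continuous_defect (hU : IsCompact U) (hne : U.Nonempty) : Continuous (defect U v τ) := by
  have h1 := continuous_width hU hne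
  have h2 := fun k => continuous_pr_left (v k)
  unfold defect
  fun_prop

/-- Crofton's formula turns a lower bound for the integrated waste into one for the total length `N
* σ`. -/
theorem integral_defect (hU : IsCompact U) (hne : U.Nonempty) {σ : ℝ} (hv : ∀ k, ‖v k‖ = σ) :
    ∫ α in (-(2 * Real.pi))..(2 * Real.pi), defect U v τ α =
      8 * (N * σ) - (∫ α in (-(2 * Real.pi))..(2 * Real.pi), width U α) + 4 * Real.pi * τ := by
  have h1 := continuous_width hU hne
  have h2 := fun k => continuous_pr_left (v k)
  have h3 : Continuous fun α => ∑ k, |pr α (v k)| := by fun_prop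
  simp only [defect]
  rw [intervalIntegral.integral_add ((by fun_prop : Continuous fun α => ∑ k, |pr α (v k)| - width U α).intervalIntegrable _ _)
      (by simp),
    intervalIntegral.integral_sub (h3.intervalIntegrable _ _) (h1.intervalIntegrable _ _),
    intervalIntegral.integral_finsetSum fun k _ => ((h2 k).abs).intervalIntegrable _ _]
  simp only [integral_abs_pr, hv, Finset.sum_const, Finset.card_univ, Fintype.card_fin,
    intervalIntegral.integral_const, smul_eq_mul, nsmul_eq_mul]
  ring

theorem sum_volume_shadow_diff_le_defect (hU : IsCompact U) (hc : Convex ℝ U) (hne : U.Nonempty)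
    {α : ℝ} (hτ : volume.real (pr α '' U \ ⋃ k, shadow α (a k) (v k)) ≤ τ) :
    ∑ k, volume.real (shadow α (a k) (v k) \ pr α '' U) ≤ defect U v τ α := by
  have hK := hU.image (continuous_pr_right α)
  have := sum_measureReal_diff_le hK.measurableSet
    (fun k => volume_shadow_ne_top α (a k) (v k)) hK.measure_lt_top.ne hτ
  simpa only [volume_real_shadow, volume_real_image_pr hU hc hne, defect] using this

theorem excess_le_defect (hU : IsCompact U) (hc : Convex ℝ U) (hne : U.Nonempty)
    {α : ℝ} (hτ : volume.real (pr α '' U \ ⋃ k, shadow α (a k) (v k)) ≤ τ) {κ : Type*} [Fintype κ]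
    {A : κ → Set ℝ} (hA : ∀ k, MeasurableSet (A k)) {r : κ → Fin N} (hr : Function.Injective r)
    (hAI : ∀ k, A k ⊆ shadow α (a (r k)) (v (r k))) :
    ∑ k, volume.real (A k) - volume.real (⋃ k, A k) ≤ defect U v τ α := by
  have h1 := sum_sub_measureReal_iUnion_le (I := fun k => shadow α (a k) (v k))
    (fun k => volume_shadow_ne_top α (a k) (v k)) hA hr hAI
  have hK := hU.image (continuous_pr_right α)
  have hf : volume (⋃ k, shadow α (a k) (v k)) ≠ ∞ :=
    ((measure_iUnion_fintype_le _ _).trans_lt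
      (ENNReal.sum_lt_top.2 fun k _ => (volume_shadow_ne_top _ _ _).lt_top)).ne
  have h2 := le_measureReal_sdiff (μ := volume) (s₁ := pr α '' U)
    (s₂ := ⋃ k, shadow α (a k) (v k)) hf
  rw [volume_real_image_pr hU hc hne] at h2
  simp only [volume_real_shadow] at h1
  simp only [defect]
  linarith

theorem defect_nonneg (hU : IsCompact U) (hc : Convex ℝ U) (hne : U.Nonempty)
    {α : ℝ} (hτ : volume.real (pr α '' U \ ⋃ k, shadow α (a k) (v k)) ≤ τ) :
    0 ≤ defect U v τ α :=
  (Finset.sum_nonneg fun _ _ => measureReal_nonneg).trans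
    (sum_volume_shadow_diff_le_defect hU hc hne hτ)

end Defect

/-! ### Segments away from the convex set -/

theorem inner_smul_dir (c β : ℝ) (x : Plane) : inner ℝ (c • dir β) x = c * pr β x := by
  rw [real_inner_smul_left, PiLp.inner_apply, Fin.sum_univ_two]
  simp [pr, mul_comm]

/-- The direction from the nearest point `u` of `U` to `z` separates them by at least `r`. Tilting
it by at most `κ` keeps `3 / 4` of this distance and raises `U` by at most `D * κ ≤ r / 4` relative
to `u`. -/
theorem exists_direction_of_far {U : Set Plane} (hU : IsCompact U) (hc : Convex ℝ U)
    (hne : U.Nonempty) {D r κ : ℝ} (hD : ∀ x ∈ U, ∀ y ∈ U, ‖x - y‖ ≤ D) (hr : 0 < r)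
    (hκ : 0 ≤ κ) (hκ1 : κ ≤ 1 / 2) (hκ2 : D * κ ≤ r / 4) {z : Plane} (hz : ∀ x ∈ U, r ≤ ‖z - x‖) :
    ∃ β ∈ Ioc (-Real.pi) Real.pi, ∀ α, |α - β| ≤ κ → ∀ x ∈ U, pr α x + r / 2 ≤ pr α z := by
  obtain ⟨u, hu, hmin⟩ := exists_norm_eq_iInf_of_complete_convex hne hU.isComplete hc z
  have hin := (norm_eq_iInf_iff_real_inner_le_zero hc hu).1 hmin
  obtain ⟨β, hβ, h⟩ := exists_eq_smul_dir (z - u)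
  have hd := hz u hu
  refine ⟨β, hβ, fun α hα x hx => ?_⟩
  have h1 : pr α z = pr α u + ‖z - u‖ * Real.cos (α - β) := by
    have : pr α (z - u) = ‖z - u‖ * Real.cos (α - β) := by
      conv_lhs => rw [h, pr_smul, pr_dir]
    rw [pr_sub] at this; linarith
  have h2 : pr β (x - u) ≤ 0 := by
    have := hin x hx
    rw [h, inner_smul_dir] at this
    exact nonpos_of_mul_nonpos_right this (hr.trans_le hd)
  have h3 := (abs_le.1 (abs_pr_sub_pr_le α β (x - u))).2
  have h4 : ‖x - u‖ * |α - β| ≤ D * κ :=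
    mul_le_mul (hD x hx u hu) hα (abs_nonneg _) ((norm_nonneg _).trans (hD x hx u hu))
  have h5 : 3 / 4 ≤ Real.cos (α - β) := by
    have := Real.one_sub_sq_div_two_le_cos (x := α - β)
    have h6 : (α - β) ^ 2 ≤ κ ^ 2 := sq_le_sq' (by linarith [(abs_le.1 hα).1]) (abs_le.1 hα).2
    nlinarith
  rw [pr_sub α] at h3
  nlinarith

/-- Bound `|cos|` below by `cos ^ 2`; the worst window is centred at the direction perpendicular to
`v`. -/
theorem le_integral_abs_pr (v : Plane) {β κ : ℝ} (hκ : 0 ≤ κ) (hκ1 : κ ≤ 1 / 2) :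
    ‖v‖ * (κ - Real.sin (2 * κ) / 2) ≤ ∫ α in (β - κ)..(β + κ), |pr α v| := by
  obtain ⟨φ, -, h⟩ := exists_eq_smul_dir v
  have h1 : ∀ α, ‖v‖ * Real.cos (α - φ) ^ 2 ≤ |pr α v| := fun α => by
    conv_rhs => rw [h, pr_smul, pr_dir, abs_mul, abs_norm]
    rw [← sq_abs]
    have h2 := Real.abs_cos_le_one (α - φ)
    gcongr
    nlinarith [abs_nonneg (Real.cos (α - φ))]
  refine le_trans ?_ (intervalIntegral.integral_mono_on (by linarith)
    ((by fun_prop : Continuous fun α => ‖v‖ * Real.cos (α - φ) ^ 2).intervalIntegrable _ _)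
    ((continuous_pr_left v).abs.intervalIntegrable _ _) fun α _ => h1 α)
  rw [intervalIntegral.integral_const_mul,
    intervalIntegral.integral_comp_sub_right (fun α => Real.cos α ^ 2) φ, integral_cos_sq]
  refine mul_le_mul_of_nonneg_left ?_ (norm_nonneg _)
  rw [show β + κ - φ = (β - φ) + κ by ring, show β - κ - φ = (β - φ) - κ by ring, Real.sin_two_mul]
  generalize β - φ = x
  have hs : 0 ≤ Real.sin κ * Real.cos κ := mul_nonneg
    (Real.sin_nonneg_of_nonneg_of_le_pi hκ (by linarith [Real.pi_gt_three]))
    (Real.cos_nonneg_of_mem_Icc ⟨by linarith [Real.pi_gt_three], by linarith [Real.pi_gt_three]⟩)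
  have h3 := Real.sin_sq_add_cos_sq x
  rw [Real.cos_add, Real.cos_sub, Real.sin_add, Real.sin_sub]
  linear_combination (Real.sin κ * Real.cos κ) * h3 +
    2 * mul_nonneg hs (sq_nonneg (Real.cos x))

theorem sub_sin_pos {κ : ℝ} (hκ : 0 < κ) : 0 < κ - Real.sin (2 * κ) / 2 := by
  have := Real.sin_lt (x := 2 * κ) (by linarith)
  linarith

/-- The total length of the segments away from `U` is controlled by the integrated defect. -/
theorem card_far_mul_le {U : Set Plane} (hU : IsCompact U) (hc : Convex ℝ U)
    (hne : U.Nonempty) {D r κ : ℝ} (hD : ∀ x ∈ U, ∀ y ∈ U, ‖x - y‖ ≤ D) (hr : 0 < r)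
    (hκ : 0 < κ) (hκ1 : κ ≤ 1 / 2) (hκ2 : D * κ ≤ r / 4) {N : ℕ} {a v : Fin N → Plane} {σ τ : ℝ}
    (hσ : σ ≤ r / 4) (hv : ∀ k, ‖v k‖ = σ)
    (hτ : ∀ α, volume.real (pr α '' U \ ⋃ k, shadow α (a k) (v k)) ≤ τ)
    (F : Finset (Fin N)) (hF : ∀ k ∈ F, ∀ x ∈ U, r ≤ ‖a k - x‖) :
    F.card * σ * (κ - Real.sin (2 * κ) / 2) ≤
      ∫ α in (-(2 * Real.pi))..(2 * Real.pi), defect U v τ α := by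
  classical
  have hb : ∀ k, ∃ β ∈ Ioc (-Real.pi) Real.pi, k ∈ F →
      ∀ α, |α - β| ≤ κ → ∀ x ∈ U, pr α x + r / 2 ≤ pr α (a k) := fun k => by
    by_cases hk : k ∈ F
    · obtain ⟨β, hβ, h⟩ := exists_direction_of_far hU hc hne hD hr hκ.le hκ1 hκ2 (hF k hk)
      exact ⟨β, hβ, fun _ => h⟩
    · exact ⟨0, ⟨by linarith [Real.pi_pos], Real.pi_pos.le⟩, fun h => absurd h hk⟩
  choose β hβ hsep using hb
  have hpi := Real.pi_gt_three
  have hJ : ∀ k, Ioc (β k - κ) (β k + κ) ⊆ Ioc (-(2 * Real.pi)) (2 * Real.pi) := fun k =>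
    Ioc_subset_Ioc (by linarith [(hβ k).1]) (by linarith [(hβ k).2])
  set q : Fin N → ℝ → ℝ := fun k => (Ioc (β k - κ) (β k + κ)).indicator fun α => |pr α (v k)|
  have hq : ∀ k, IntegrableOn (q k) (Ioc (-(2 * Real.pi)) (2 * Real.pi)) := fun k =>
    ((continuous_pr_left (v k)).abs.integrableOn_Ioc).indicator measurableSet_Ioc
  have hpt : ∀ α, ∑ k ∈ F, q k α ≤ defect U v τ α := fun α => by
    refine le_trans ?_ (sum_volume_shadow_diff_le_defect hU hc hne (hτ α))
    refine le_trans (Finset.sum_le_sum fun k hk => ?_)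
      (Finset.sum_le_univ_sum_of_nonneg fun k => measureReal_nonneg)
    by_cases hα : α ∈ Ioc (β k - κ) (β k + κ)
    · simp only [q, indicator_of_mem hα]
      -- Inside its window the whole shadow is wasted: the starting point clears `U` by `r / 2`, and
      -- the segment has length at most `r / 4`.
      rw [← volume_real_shadow α (a k) (v k), sdiff_eq_left.2]
      rw [Set.disjoint_left]
      rintro t ht ⟨x, hx, rfl⟩
      obtain ⟨s, hs, h⟩ := exists_of_mem_shadow ht
      have h1 := hsep k hk α (abs_le.2 ⟨by linarith [hα.1], by linarith [hα.2]⟩) x hx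
      have h2 := (abs_le.1 (abs_pr_le α (v k))).1
      rw [pr_add, pr_smul] at h
      rw [hv k] at h2
      nlinarith [hs.1, hs.2]
    · simp only [q, indicator_of_notMem hα]
      exact measureReal_nonneg
  rw [intervalIntegral.integral_of_le (by linarith)]
  calc F.card * σ * (κ - Real.sin (2 * κ) / 2)
      = ∑ k ∈ F, ‖v k‖ * (κ - Real.sin (2 * κ) / 2) := by simp [hv, mul_assoc]
    _ ≤ ∑ k ∈ F, ∫ α in Ioc (-(2 * Real.pi)) (2 * Real.pi), q k α := by
        refine Finset.sum_le_sum fun k _ => (le_integral_abs_pr (v k) (β := β k) hκ.le hκ1).trans ?_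
        rw [setIntegral_indicator measurableSet_Ioc, inter_eq_right.2 (hJ k),
          intervalIntegral.integral_of_le (by linarith)]
    _ = ∫ α in Ioc (-(2 * Real.pi)) (2 * Real.pi), ∑ k ∈ F, q k α :=
        (integral_finsetSum _ fun k _ => hq k).symm
    _ ≤ _ := integral_mono (integrable_finsetSum _ fun k _ => hq k)
        ((continuous_defect hU hne).integrableOn_Ioc) hpt

/-! ### Crossing families of segments -/

/-- The cross product of plane vectors. -/
def cross (v w : Plane) : ℝ := v 0 * w 1 - v 1 * w 0

/-- Take as `b` the endpoint with the smaller coordinate at `α₀`. Turning by at most `κ` changes the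
signed shadow length by at most half of `l * σ`, so the same `b` serves for all these angles. -/
theorem exists_base {a v : Plane} {α₀ κ l σ : ℝ} (hv : ‖v‖ = σ) (hσ : 0 < σ) (hl : 2 * κ ≤ l)
    (h : l * σ ≤ |pr α₀ v|) :
    ∃ b : Plane, ‖b - a‖ ≤ σ ∧ ∀ α, |α - α₀| ≤ κ →
      Ico (pr α b) (pr α b + l / 2 * σ) ⊆ shadow α a v := by
  have key : ∀ α, |α - α₀| ≤ κ → |pr α v - pr α₀ v| ≤ l / 2 * σ := fun α hα => by
    have := abs_pr_sub_pr_le α α₀ v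
    rw [hv] at this
    nlinarith
  rcases le_abs.1 h with h | h
  · refine ⟨a, by simpa using hσ.le, fun α hα => Ico_subset_shadow ?_⟩
    linarith [(abs_le.1 (key α hα)).1]
  · refine ⟨a + v, by simp [hv], fun α hα => ?_⟩
    rw [← shadow_swap]
    refine Ico_subset_shadow ?_
    rw [pr_neg]
    linarith [(abs_le.1 (key α hα)).2]

/-- `α₀` is the angle of `E` minus a right angle: there `E` is seen end-on, and the cross product
with `E` measures the shadow of `v`. -/
theorem exists_angle_of_ne (E : Plane) : ∃ α₀, -(3 / 2 * Real.pi) < α₀ ∧ α₀ ≤ Real.pi / 2 ∧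
    (∀ α, pr α E = ‖E‖ * Real.sin (α - α₀)) ∧ ∀ v, cross v E = ‖E‖ * pr α₀ v := by
  obtain ⟨ψ, hψ, h⟩ := exists_eq_smul_dir E
  refine ⟨ψ - Real.pi / 2, by linarith [hψ.1], by linarith [hψ.2], fun α => ?_, fun v => ?_⟩
  · conv_lhs => rw [h, pr_smul, pr_dir]
    rw [show α - (ψ - Real.pi / 2) = α - ψ + Real.pi / 2 by ring, Real.sin_add_pi_div_two]
  · conv_lhs => rw [h]
    simp only [cross, PiLp.smul_apply, dir_zero, dir_one, smul_eq_mul, pr, Real.cos_sub_pi_div_two,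
      Real.sin_sub_pi_div_two]
    ring

/-- At `α₀` the points `x` and `y` have the same projection. On turning from `α₀ - κ` to `α₀ + κ`
the shadows near `y` move from the left of those near `x` to the right, with speed at most `R + 1`.
-/
theorem le_integral_defect_of_crossing {U : Set Plane} (hU : IsCompact U) (hc : Convex ℝ U)
    (hne : U.Nonempty) {N m : ℕ} {a v : Fin N → Plane} {σ τ : ℝ} (hσ : 0 < σ)
    (hv : ∀ k, ‖v k‖ = σ)
    (hτ : ∀ α, volume.real (pr α '' U \ ⋃ k, shadow α (a k) (v k)) ≤ τ)
    {x y : Plane} {d D s κ ρ R : ℝ} (hd : 0 < d) (hxy : d ≤ ‖y - x‖) (hD : ‖y - x‖ ≤ D)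
    (hκ : 0 < κ) (hκ1 : κ ≤ 1) (hκs : 2 * κ ≤ s / D) (hρ : ρ ≤ d * κ / 24) (hσρ : σ ≤ ρ)
    (hρ1 : 3 * ρ ≤ 1) (hx : ‖x‖ ≤ R) (hy : ‖y‖ ≤ R) {p q : Fin (m + 1) → Fin N}
    (hp : Function.Injective p) (hq : Function.Injective q)
    (hpx : ∀ k, ‖a (p k) - x‖ < 2 * ρ) (hqy : ∀ k, ‖a (q k) - y‖ < 2 * ρ)
    (hps : ∀ k, s * σ ≤ |cross (v (p k)) (y - x)|) (hqs : ∀ k, s * σ ≤ |cross (v (q k)) (y - x)|)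
    (hm : (m + 1) * (s / D / 2 * σ) ≤ d * κ / 4) :
    ((m + 1) * (s / D / 2 * σ)) ^ 2 / (4 * (R + 1)) ≤
      ∫ α in (-(2 * Real.pi))..(2 * Real.pi), defect U v τ α := by
  have hE : 0 < ‖y - x‖ := hd.trans_le hxy
  have hD0 : 0 < D := hE.trans_le hD
  have hR : 0 ≤ R := (norm_nonneg _).trans hx
  set w := s / D / 2 * σ with hw
  have hw0 : 0 < w := by have : 0 < s / D := by linarith
                         positivity
  obtain ⟨α₀, hα₁, hα₂, hprE, hcross⟩ := exists_angle_of_ne (y - x)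
  have hlow : ∀ k, s * σ ≤ |cross (v k) (y - x)| → s / D * σ ≤ |pr α₀ (v k)| := fun k hk => by
    rw [hcross, abs_mul, abs_norm] at hk
    rw [div_mul_eq_mul_div, div_le_iff₀ hD0]
    nlinarith [abs_nonneg (pr α₀ (v k))]
  choose bp hbp hbp' using fun k =>
    exists_base (a := a (p k)) (hv (p k)) hσ hκs (hlow (p k) (hps k))
  choose bq hbq hbq' using fun k =>
    exists_base (a := a (q k)) (hv (q k)) hσ hκs (hlow (q k) (hqs k))
  have hbpx : ∀ k, ‖bp k - x‖ ≤ 3 * ρ := fun k => by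
    have := norm_add_le (bp k - a (p k)) (a (p k) - x)
    rw [sub_add_sub_cancel] at this
    linarith [hbp k, hpx k]
  have hbqy : ∀ k, ‖bq k - y‖ ≤ 3 * ρ := fun k => by
    have := norm_add_le (bq k - a (q k)) (a (q k) - y)
    rw [sub_add_sub_cancel] at this
    linarith [hbq k, hqy k]
  have hbpn : ∀ k, ‖bp k‖ ≤ R + 1 := fun k => by
    have := norm_add_le (bp k - x) x
    rw [sub_add_cancel] at this
    linarith [hbpx k]
  have hbqn : ∀ k, ‖bq k‖ ≤ R + 1 := fun k => by
    have := norm_add_le (bq k - y) y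
    rw [sub_add_cancel] at this
    linarith [hbqy k]
  -- At the two extreme angles `x` and `y` project at least this far apart. The base points account
  -- for at most `6 * ρ ≤ d * κ / 4`, leaving the gap `d * κ / 4` that the crossing argument needs.
  have hsin : d * κ / 2 ≤ ‖y - x‖ * Real.sin κ := by
    have h1 := Real.mul_le_sin hκ.le (by linarith [Real.pi_gt_three])
    have h2 : 1 / 2 ≤ 2 / Real.pi := by
      rw [div_le_div_iff₀ (by norm_num) Real.pi_pos]; linarith [Real.pi_le_four]
    have h3 : κ / 2 ≤ Real.sin κ := by nlinarith
    nlinarith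
  have hdisj : ∀ k l, p k ≠ q l := fun k l h => by
    have h1 := norm_add_le (y - a (q l)) (a (p k) - x)
    rw [h, sub_add_sub_cancel, norm_sub_rev y (a (q l))] at h1
    have := hqy l; have := hpx k; rw [h] at this
    nlinarith
  obtain ⟨G, hGc, hG0, hG1, hG2⟩ := exists_overlap_of_crossing (K := R + 1) (w := w)
    (fun k α => pr α (bq k)) (fun k α => pr α (bp k)) (a := α₀ - κ) (b := α₀ + κ) (by linarith) hw0
    (by linarith)
    (fun k s t => (abs_pr_sub_pr_le s t _).trans
      (mul_le_mul_of_nonneg_right (hbqn k) (abs_nonneg _)))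
    (fun k s t => (abs_pr_sub_pr_le s t _).trans
      (mul_le_mul_of_nonneg_right (hbpn k) (abs_nonneg _)))
    (fun k l => by
      have h1 := hprE (α₀ - κ)
      rw [show α₀ - κ - α₀ = -κ by ring, Real.sin_neg, pr_sub] at h1
      have h2 := (abs_le.1 ((abs_pr_le (α₀ - κ) _).trans (hbpx l))).1
      have h3 := (abs_le.1 ((abs_pr_le (α₀ - κ) _).trans (hbqy k))).2
      rw [pr_sub] at h2 h3
      linarith)
    (fun k l => by
      have h1 := hprE (α₀ + κ)
      rw [show α₀ + κ - α₀ = κ by ring, pr_sub] at h1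
      have h2 := (abs_le.1 ((abs_pr_le (α₀ + κ) _).trans (hbpx l))).2
      have h3 := (abs_le.1 ((abs_pr_le (α₀ + κ) _).trans (hbqy k))).1
      rw [pr_sub] at h2 h3
      linarith)
  have hdc : Continuous (defect U v τ) := continuous_defect hU hne
  refine hG2.trans ((intervalIntegral.integral_mono_on (by linarith)
    (hGc.intervalIntegrable _ _) (hdc.intervalIntegrable _ _) fun α hα => ?_).trans
    (intervalIntegral.integral_mono_interval (by linarith [Real.pi_gt_three]) (by linarith)
      (by linarith [Real.pi_gt_three]) (Filter.Eventually.of_forall fun α =>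
        defect_nonneg hU hc hne (hτ α)) (hdc.intervalIntegrable _ _)))
  have hα' : |α - α₀| ≤ κ := abs_le.2 ⟨by linarith [hα.1], by linarith [hα.2]⟩
  refine (hG1 α).trans ?_
  have := excess_le_defect hU hc hne (hτ α) (κ := Fin (m + 1) ⊕ Fin (m + 1))
    (A := Sum.elim (fun k => Ico (pr α (bq k)) (pr α (bq k) + w))
      fun k => Ico (pr α (bp k)) (pr α (bp k) + w))
    (r := Sum.elim q p) (by rintro (k | k) <;> exact measurableSet_Ico)
    (hq.sumElim hp fun k l h => hdisj l k h.symm)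
    (by rintro (k | k)
        · exact hbq' k α hα'
        · exact hbp' k α hα')
  rw [Fintype.sum_sum_type, iUnion_sum] at this
  simp only [Sum.elim_inl, Sum.elim_inr, Real.volume_real_Ico_of_le (le_add_of_nonneg_right hw0.le),
    add_sub_cancel_left, Finset.sum_const, Finset.card_univ, Fintype.card_fin, nsmul_eq_mul,
    Nat.cast_add, Nat.cast_one] at this
  linarith

/-! ### Segments near an extreme point -/

/-- A segment starting near `U` but not near `e` starts within `r` of a point of `U` outside the
slice, so its shadow stays below `c + r + σ ≤ c + g`. Only `B` and `F` can cover the strip from `c +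
g` to `c + 2 * g`. -/
theorem slice_le_card {U : Set Plane} (hc : Convex ℝ U) {N : ℕ} {a v : Fin N → Plane} {σ τ : ℝ}
    (hv : ∀ k, ‖v k‖ = σ) {α : ℝ}
    (hτ : volume.real (pr α '' U \ ⋃ k, shadow α (a k) (v k)) ≤ τ) {e y : Plane} {ρ r c g : ℝ}
    (he : e ∈ U) (hy : y ∈ U) (hye : ρ ≤ ‖y - e‖) (hec : c + 2 * g ≤ pr α e)
    (hslice : ∀ x ∈ U, ρ ≤ ‖x - e‖ → pr α x ≤ c) (hrg : r + σ ≤ g) (hrρ : r ≤ ρ) (hg : 0 < g)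
    {F B : Finset (Fin N)} (hF : ∀ k ∉ F, ∃ x ∈ U, ‖a k - x‖ < r)
    (hB : ∀ k ∉ B, 2 * ρ ≤ ‖a k - e‖) (hU : IsCompact U) :
    g ≤ τ + (B.card + F.card) * σ := by
  classical
  have hsub : Ioo (c + g) (c + 2 * g) ⊆ (pr α '' U \ ⋃ k, shadow α (a k) (v k)) ∪
      ⋃ k ∈ B ∪ F, shadow α (a k) (v k) := by
    intro t ht
    -- The point `y` lies below the strip and `e` above it, so the projection of `U` contains the
    -- strip.
    have htU : t ∈ pr α '' U :=
      (hc.isPreconnected.image _ (continuous_pr_right α).continuousOn).Icc_subset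
        ⟨y, hy, rfl⟩ ⟨e, he, rfl⟩ ⟨by linarith [hslice y hy hye, ht.1], by linarith [ht.2]⟩
    by_cases h : t ∈ ⋃ k, shadow α (a k) (v k)
    · obtain ⟨k, hk⟩ := mem_iUnion.1 h
      refine Or.inr (mem_biUnion (x := k) ?_ hk)
      by_contra hkBF
      simp only [Finset.coe_union, mem_union, Finset.mem_coe, not_or] at hkBF
      obtain ⟨x, hx, hxr⟩ := hF k hkBF.2
      have h1 := norm_add_le (a k - x) (x - e)
      rw [sub_add_sub_cancel] at h1
      have h2 := hslice x hx (by linarith [hB k hkBF.1])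
      obtain ⟨s, hs, rfl⟩ := exists_of_mem_shadow hk
      have h3 := (abs_le.1 (abs_pr_le α (v k))).2
      have h4 := (abs_le.1 (abs_pr_le α (a k - x))).2
      rw [hv k] at h3
      rw [pr_sub] at h4
      have h5 := ht.1
      rw [pr_add, pr_smul] at h5
      have h6 : 0 ≤ σ := by rw [← hv k]; exact norm_nonneg _
      nlinarith [hs.1, hs.2]
    · exact Or.inl ⟨htU, h⟩
  have hfin : volume ((pr α '' U \ ⋃ k, shadow α (a k) (v k)) ∪
      ⋃ k ∈ B ∪ F, shadow α (a k) (v k)) ≠ ∞ := by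
    refine (measure_union_lt_top ?_ ?_).ne
    · exact (measure_mono sdiff_subset).trans_lt
        (hU.image (continuous_pr_right α)).measure_lt_top
    · exact measure_biUnion_lt_top (Finset.finite_toSet _) fun k _ =>
        (volume_shadow_ne_top α (a k) (v k)).lt_top
  have h1 := (measureReal_mono hsub hfin).trans ((measureReal_union_le _ _).trans
    (add_le_add hτ (measureReal_biUnion_finset_le _ _)))
  rw [Real.volume_real_Ioo_of_le (by linarith)] at h1
  have h2 : ∑ k ∈ B ∪ F, volume.real (shadow α (a k) (v k)) ≤ (B ∪ F).card * σ := by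
    rw [← nsmul_eq_mul]
    refine Finset.sum_le_card_nsmul _ _ _ fun k _ => ?_
    rw [volume_real_shadow, ← hv k]
    exact abs_pr_le _ _
  have h3 : ((B ∪ F).card : ℝ) * σ ≤ (B.card + F.card) * σ := by
    rcases N.eq_zero_or_pos with h | h
    · subst h; simp [Finset.eq_empty_of_isEmpty]
    · have : 0 ≤ σ := by rw [← hv ⟨0, h⟩]; exact norm_nonneg _
      gcongr
      exact_mod_cast Finset.card_union_le _ _
  linarith

/-! ### Selection of a transversal pair -/

/-- By the identity `h` below, a vector cannot be nearly parallel to two transversal directions. -/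
theorem norm_mul_abs_cross_le (v E E' : Plane) :
    ‖v‖ * |cross E E'| ≤ |cross v E'| * ‖E‖ + |cross v E| * ‖E'‖ := by
  have h : (cross E E') • v = (cross v E') • E - (cross v E) • E' := by
    ext i
    fin_cases i <;> simp [cross] <;> ring
  have h1 : ‖v‖ * |cross E E'| = ‖(cross E E') • v‖ := by rw [norm_smul, Real.norm_eq_abs, mul_comm]
  rw [h1, h]
  refine (norm_sub_le _ _).trans (le_of_eq ?_)
  rw [norm_smul, norm_smul, Real.norm_eq_abs, Real.norm_eq_abs]

theorem cross_neg_right (v E : Plane) : cross v (-E) = -cross v E := by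
  simp [cross]; ring

/-- Among four vertices there is a pair without an arc between them if every vertex has at most one
outgoing arc. -/
theorem exists_pair_of_unique_out (P : Fin 4 → Fin 4 → Prop)
    (h : ∀ i j k, i ≠ j → i ≠ k → j ≠ k → P i j → ¬ P i k) :
    ∃ i j, i ≠ j ∧ ¬ P i j ∧ ¬ P j i := by
  by_contra! hP
  -- If every pair is joined, both `j` and `k` point to `i`, and the arc between them is a second
  -- outgoing one. So no vertex can miss two others, although `0` points to at most one of three.
  have key : ∀ i j k, i ≠ j → i ≠ k → j ≠ k → ¬ P i j → ¬ P i k → False := by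
    intro i j k hij hik hjk h1 h2
    by_cases h3 : P j k
    · exact h j i k hij.symm hjk hik (hP i j hij h1) h3
    · exact h k i j hik.symm hjk.symm hij (hP i k hik h2) (hP j k hjk h3)
  by_cases h1 : P 0 1
  · exact key 0 2 3 (by decide) (by decide) (by decide)
      (h 0 1 2 (by decide) (by decide) (by decide) h1)
      (h 0 1 3 (by decide) (by decide) (by decide) h1)
  · by_cases h2 : P 0 2
    · exact key 0 1 3 (by decide) (by decide) (by decide) h1
        (h 0 2 3 (by decide) (by decide) (by decide) h2)
    · exact key 0 1 2 (by decide) (by decide) (by decide) h1 h2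

/-- Draw an arc from `i` to `j` when more than half of `B i` is nearly parallel to `e j - e i`. Two
arcs out of `i` would give one segment nearly parallel to two transversal directions. -/
theorem exists_transversal_pair {N : ℕ} {v : Fin N → Plane} {σ s D : ℝ} (hσ : 0 < σ)
    (hv : ∀ k, ‖v k‖ = σ) {e : Fin 4 → Plane} (hD : ∀ i j, ‖e i - e j‖ ≤ D) (hs : 0 < s)
    (hcross : ∀ i j k, i ≠ j → i ≠ k → j ≠ k → 2 * s * D < |cross (e j - e i) (e k - e i)|)
    (B : Fin 4 → Finset (Fin N)) :
    ∃ i j, i ≠ j ∧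
      (B i).card ≤ 2 * ((B i).filter fun k => s * σ ≤ |cross (v k) (e j - e i)|).card ∧
      (B j).card ≤ 2 * ((B j).filter fun k => s * σ ≤ |cross (v k) (e j - e i)|).card := by
  have hout : ∀ i j k : Fin 4, i ≠ j → i ≠ k → j ≠ k →
      2 * ((B i).filter fun k => s * σ ≤ |cross (v k) (e j - e i)|).card < (B i).card →
      ¬ 2 * ((B i).filter fun l => s * σ ≤ |cross (v l) (e k - e i)|).card < (B i).card := by
    intro i j k hij hik hjk h1 h2
    have h3 : (((B i).filter fun l => s * σ ≤ |cross (v l) (e j - e i)|) ∪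
        ((B i).filter fun l => s * σ ≤ |cross (v l) (e k - e i)|)).card < (B i).card :=
      (Finset.card_union_le _ _).trans_lt (by omega)
    obtain ⟨l, hl, hl'⟩ := Finset.exists_mem_notMem_of_card_lt_card h3
    simp only [Finset.mem_union, Finset.mem_filter, hl, true_and, not_or, not_le] at hl'
    have h4 := norm_mul_abs_cross_le (v l) (e j - e i) (e k - e i)
    rw [hv l] at h4
    have h5 := hcross i j k hij hik hjk
    have h6 := mul_le_mul hl'.1.le (hD k i) (norm_nonneg _) (by positivity)
    have h7 := mul_le_mul hl'.2.le (hD j i) (norm_nonneg _) (by positivity)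
    nlinarith
  obtain ⟨i, j, hij, h1, h2⟩ := exists_pair_of_unique_out (fun i j =>
    2 * ((B i).filter fun k => s * σ ≤ |cross (v k) (e j - e i)|).card < (B i).card) hout
  refine ⟨i, j, hij, not_lt.1 h1, ?_⟩
  have h3 : ∀ w, |cross w (e j - e i)| = |cross w (e i - e j)| := fun w => by
    rw [← neg_sub, cross_neg_right, abs_neg]
  simpa only [h3] using not_lt.1 h2

/-! ### The quantitative gap for families of segments -/

theorem exists_pos_forall_le {ι : Type*} [Finite ι] {f : ι → ℝ} (hf : ∀ i, 0 < f i) :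
    ∃ c > 0, ∀ i, c ≤ f i := by
  rcases isEmpty_or_nonempty ι with h | h
  · exact ⟨1, one_pos, fun i => h.elim i⟩
  · obtain ⟨i, hi⟩ := Finite.exists_min f
    exact ⟨f i, hf i, hi⟩

theorem exists_injective_mem {N n : ℕ} {T : Finset (Fin N)} (h : n ≤ T.card) :
    ∃ p : Fin n → Fin N, Function.Injective p ∧ ∀ k, p k ∈ T :=
  ⟨fun k => (T.equivFin.symm (Fin.castLE h k)).1, fun k l hkl => by
    simpa using Subtype.ext hkl, fun k => (T.equivFin.symm (Fin.castLE h k)).2⟩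

-- If the integrated defect were below `η`, the far segments would have total length below `g / 4`,
-- so each cluster would have at least `g / 2`, and the transversal half at least `g / 4 ≥ M`.
-- Crossing subfamilies of length about `M` then already waste `η`.
set_option maxHeartbeats 800000 in
theorem exists_gap {U : Set Plane} (hU : IsCompact U) (hc : Convex ℝ U) {e : Fin 4 → Plane}
    (he : ∀ i, e i ∈ U) (hinj : Function.Injective e)
    (hcr : ∀ i j k, i ≠ j → i ≠ k → j ≠ k → cross (e j - e i) (e k - e i) ≠ 0)
    (hslice : ∀ ρ > 0, ∃ g > 0, ∀ i, ∃ α c, c + 2 * g ≤ pr α (e i) ∧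
      ∀ x ∈ U, ρ ≤ ‖x - e i‖ → pr α x ≤ c) :
    ∃ δ > 0, ∃ τ > 0, ∃ σ₀ > 0, ∀ (N : ℕ) (a v : Fin N → Plane) (σ : ℝ), 0 < σ → σ ≤ σ₀ →
      (∀ k, ‖v k‖ = σ) →
      (∀ α, volume.real (pr α '' U \ ⋃ k, shadow α (a k) (v k)) ≤ τ) →
      (∫ α in (-(2 * Real.pi))..(2 * Real.pi), width U α) + δ ≤ 8 * (N * σ) := by
  classical
  have hne : U.Nonempty := ⟨e 0, he 0⟩
  obtain ⟨R, hR⟩ := hU.isBounded.exists_norm_le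
  have hR0 : 0 ≤ R := (norm_nonneg _).trans (hR _ (he 0))
  obtain ⟨D, hD0, hD⟩ : ∃ D : ℝ, 0 < D ∧ ∀ x ∈ U, ∀ y ∈ U, ‖x - y‖ ≤ D :=
    ⟨2 * R + 1, by positivity, fun x hx y hy =>
      (norm_sub_le _ _).trans (by linarith [hR x hx, hR y hy])⟩
  obtain ⟨s, hs, hcross⟩ : ∃ s : ℝ, 0 < s ∧ ∀ i j k, i ≠ j → i ≠ k → j ≠ k →
      2 * s * D < |cross (e j - e i) (e k - e i)| := by
    obtain ⟨c, hc0, hc⟩ := exists_pos_forall_le (ι := Fin 4 × Fin 4 × Fin 4)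
      (f := fun p => if p.1 ≠ p.2.1 ∧ p.1 ≠ p.2.2 ∧ p.2.1 ≠ p.2.2 then
        |cross (e p.2.1 - e p.1) (e p.2.2 - e p.1)| else 1) (fun p => by
          split_ifs with h
          · exact abs_pos.2 (hcr _ _ _ h.1 h.2.1 h.2.2)
          · exact one_pos)
    refine ⟨c / (4 * D), by positivity, fun i j k hij hik hjk => ?_⟩
    have := hc (i, j, k)
    simp only [hij, hik, hjk, ne_eq, not_false_eq_true, and_self, if_true] at this
    have h2 : 2 * (c / (4 * D)) * D = c / 2 := by field_simp; norm_num
    linarith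
  obtain ⟨d, hd, hdist⟩ : ∃ d : ℝ, 0 < d ∧ ∀ i j, i ≠ j → d ≤ ‖e j - e i‖ := by
    obtain ⟨c, hc0, hc⟩ := exists_pos_forall_le (ι := Fin 4 × Fin 4)
      (f := fun p => if p.1 ≠ p.2 then ‖e p.2 - e p.1‖ else 1) (fun p => by
          split_ifs with h
          · exact norm_pos_iff.2 (sub_ne_zero.2 fun h' => h (hinj h'.symm))
          · exact one_pos)
    refine ⟨c, hc0, fun i j hij => ?_⟩
    have := hc (i, j)
    simpa only [hij, ne_eq, not_false_eq_true, if_true] using this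
  obtain ⟨κ, hκ, hκ1, hκs⟩ : ∃ κ : ℝ, 0 < κ ∧ κ ≤ 1 ∧ 2 * κ ≤ s / D :=
    ⟨min 1 (s / D / 2), by positivity, min_le_left _ _, by linarith [min_le_right 1 (s / D / 2)]⟩
  obtain ⟨ρ, hρ, hρ1, hρd⟩ : ∃ ρ : ℝ, 0 < ρ ∧ 3 * ρ ≤ 1 ∧ ρ ≤ d * κ / 24 :=
    ⟨min (1 / 3) (d * κ / 24), by positivity, by linarith [min_le_left (1 / 3) (d * κ / 24)],
      min_le_right _ _⟩
  obtain ⟨g, hg, hsl⟩ := hslice ρ hρ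
  obtain ⟨r, hr, hrρ, hrg⟩ : ∃ r : ℝ, 0 < r ∧ r ≤ ρ ∧ r ≤ g / 2 :=
    ⟨min ρ (g / 2), by positivity, min_le_left _ _, min_le_right _ _⟩
  obtain ⟨κ', hκ', hκ'1, hκ'r⟩ : ∃ κ' : ℝ, 0 < κ' ∧ κ' ≤ 1 / 2 ∧ D * κ' ≤ r / 4 := by
    refine ⟨min (1 / 2) (r / (4 * D)), by positivity, min_le_left _ _, ?_⟩
    refine (mul_le_mul_of_nonneg_left (min_le_right _ _) hD0.le).trans (le_of_eq ?_)
    field_simp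
  have hc'0 := sub_sin_pos hκ'
  set c' := κ' - Real.sin (2 * κ') / 2
  obtain ⟨l, hl⟩ : ∃ l, l = s / D / 2 := ⟨_, rfl⟩
  have hl0 : 0 < l := by rw [hl]; positivity
  obtain ⟨M, hM, hMg, hMl⟩ : ∃ M : ℝ, 0 < M ∧ M ≤ g / 4 ∧ l * M ≤ d * κ / 4 := by
    refine ⟨min (g / 4) (d * κ / 4 / l), by positivity, min_le_left _ _, ?_⟩
    refine (mul_le_mul_of_nonneg_left (min_le_right _ _) hl0.le).trans (le_of_eq ?_)
    field_simp
  obtain ⟨η, hη, hη1, hη2⟩ : ∃ η : ℝ, 0 < η ∧ η ≤ (l * (M / 2)) ^ 2 / (4 * (R + 1)) ∧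
      η ≤ c' * (g / 4) :=
    ⟨min ((l * (M / 2)) ^ 2 / (4 * (R + 1))) (c' * (g / 4)), by positivity, min_le_left _ _,
      min_le_right _ _⟩
  -- Half of `η` pays for the term `4 * π * τ` in the integrated defect; the other half is the gap.
  obtain ⟨τ, hτ0, hτg, hτη⟩ : ∃ τ : ℝ, 0 < τ ∧ τ ≤ g / 4 ∧ 4 * Real.pi * τ ≤ η / 2 := by
    have := Real.pi_pos
    refine ⟨min (g / 4) (η / (8 * Real.pi)), by positivity, min_le_left _ _, ?_⟩
    refine (mul_le_mul_of_nonneg_left (min_le_right _ _) (by positivity)).trans (le_of_eq ?_)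
    field_simp; norm_num
  refine ⟨η / 2, by positivity, τ, hτ0, min M (r / 4), by positivity, ?_⟩
  intro N a v σ hσ hσ0 hv hτ
  by_contra! hlt
  have hσM : σ ≤ M := hσ0.trans (min_le_left _ _)
  have hσr : σ ≤ r / 4 := hσ0.trans (min_le_right _ _)
  have hint := integral_defect (τ := τ) hU hne hv
  have hintη : ∫ α in (-(2 * Real.pi))..(2 * Real.pi), defect U v τ α < η := by
    rw [hint]; linarith
  set F : Finset (Fin N) := Finset.univ.filter fun k => ∀ x ∈ U, r ≤ ‖a k - x‖ with hF
  have hFc : F.card * σ < g / 4 := by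
    have h1 := card_far_mul_le hU hc hne hD hr hκ' hκ'1 hκ'r hσr hv hτ F (fun k hk => by
      simpa [hF] using hk)
    have h2 := (h1.trans_lt hintη).trans_le hη2
    rw [mul_comm c'] at h2
    exact lt_of_mul_lt_mul_right h2 hc'0.le
  set B : Fin 4 → Finset (Fin N) := fun i =>
    Finset.univ.filter fun k => ‖a k - e i‖ < 2 * ρ with hB
  have hBc : ∀ i, g / 2 ≤ (B i).card * σ := fun i => by
    obtain ⟨α, c, hec, hx⟩ := hsl i
    obtain ⟨j, hj⟩ : ∃ j, j ≠ i := exists_ne i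
    have hye : ρ ≤ ‖e j - e i‖ := by
      have := hdist i j hj.symm
      nlinarith
    have := slice_le_card hc hv (hτ α) (r := r) (F := F) (B := B i) (he i) (he j) hye hec hx
      (by linarith) hrρ hg (fun k hk => by simpa [hF] using hk)
      (fun k hk => by simpa [hB] using hk) hU
    linarith
  obtain ⟨i, j, hij, hi, hj⟩ := exists_transversal_pair hσ hv
    (fun i j => hD _ (he i) _ (he j)) hs hcross B
  set Ti := (B i).filter fun k => s * σ ≤ |cross (v k) (e j - e i)| with hTi
  set Tj := (B j).filter fun k => s * σ ≤ |cross (v k) (e j - e i)| with hTj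
  -- Exactly `m + 1` segments are kept in each cluster, of total length between `M / 2` and `M`:
  -- enough to waste `η`, yet short enough to fit in the gap at the extreme angles.
  obtain ⟨m, hm⟩ : ∃ m, ⌊M / σ⌋₊ = m + 1 := Nat.exists_eq_succ_of_ne_zero
    (Nat.floor_pos.2 ((one_le_div hσ).2 hσM)).ne'
  have hm1 : (m + 1 : ℝ) * σ ≤ M := by
    have := Nat.floor_le (div_nonneg hM.le hσ.le)
    rw [hm, le_div_iff₀ hσ] at this
    exact_mod_cast this
  have hm2 : M / 2 ≤ (m + 1 : ℝ) * σ := by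
    have := Nat.lt_floor_add_one (M / σ)
    rw [hm, div_lt_iff₀ hσ] at this
    push_cast at this
    have hm0 : (0 : ℝ) ≤ m * σ := by positivity
    linarith
  have hcard : ∀ n n' : ℕ, n ≤ 2 * n' → g / 2 ≤ n * σ → m + 1 ≤ n' := fun n n' h1 h2 => by
    have h3 : (n : ℝ) ≤ 2 * n' := by exact_mod_cast h1
    have h4 : (m + 1 : ℝ) * σ ≤ n' * σ := by nlinarith
    exact_mod_cast le_of_mul_le_mul_right h4 hσ
  obtain ⟨p, hp, hpT⟩ := exists_injective_mem (hcard _ _ hi (hBc i))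
  obtain ⟨q, hq, hqT⟩ := exists_injective_mem (hcard _ _ hj (hBc j))
  have hfinal := le_integral_defect_of_crossing hU hc hne hσ hv hτ hd (hdist i j hij)
    (hD _ (he j) _ (he i)) hκ hκ1 hκs hρd (by linarith) hρ1 (hR _ (he i)) (hR _ (he j)) hp hq
    (fun k => by have := hpT k; simp only [hTi, hB, Finset.mem_filter] at this; exact this.1.2)
    (fun k => by have := hqT k; simp only [hTj, hB, Finset.mem_filter] at this; exact this.1.2)
    (fun k => (Finset.mem_filter.1 (hpT k)).2) (fun k => (Finset.mem_filter.1 (hqT k)).2)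
    (by rw [← hl, mul_left_comm]; exact (mul_le_mul_of_nonneg_left hm1 hl0.le).trans hMl)
  rw [← hl] at hfinal
  have h5 : (l * (M / 2)) ^ 2 / (4 * (R + 1)) ≤ ((m + 1) * (l * σ)) ^ 2 / (4 * (R + 1)) := by
    have h6 : l * (M / 2) ≤ (m + 1) * (l * σ) := by
      rw [mul_left_comm]; exact mul_le_mul_of_nonneg_left hm2 hl0.le
    exact div_le_div_of_nonneg_right (pow_le_pow_left₀ (by positivity) h6 2) (by positivity)
  linarith

/-! ### Approximating rectifiable sets by segments -/

theorem norm_sq_eq_pr (α : ℝ) (z : Plane) : ‖z‖ ^ 2 = pr α z ^ 2 + pr (α + Real.pi / 2) z ^ 2 := by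
  rw [norm_sq_eq, pr, pr, Real.cos_add_pi_div_two, Real.sin_add_pi_div_two]
  have := Real.sin_sq_add_cos_sq α
  linear_combination (-(z 0 ^ 2 + z 1 ^ 2)) * this

/-- Reflecting `b` in the line through `z` perpendicular to direction `α` straightens the path; the
inequality `h4` is this triangle inequality in Cauchy–Schwarz form. -/
theorem sq_add_le_of_pr_le {α k : ℝ} {a b z : Plane} (hk : 0 ≤ k) (ha : pr α a + k ≤ pr α z)
    (hb : pr α b + k ≤ pr α z) : ‖b - a‖ ^ 2 + 4 * k ^ 2 ≤ (‖z - a‖ + ‖b - z‖) ^ 2 := by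
  rw [norm_sub_rev b z]
  have h1 := norm_sq_eq_pr α (z - a)
  have h2 := norm_sq_eq_pr α (z - b)
  have h3 := norm_sq_eq_pr α (b - a)
  simp only [pr_sub] at h1 h2 h3
  set p := pr α z - pr α a
  set q := pr α z - pr α b
  have hp : k ≤ p := by simp only [p]; linarith
  have hq : k ≤ q := by simp only [q]; linarith
  set p' := pr (α + Real.pi / 2) z - pr (α + Real.pi / 2) a
  set q' := pr (α + Real.pi / 2) z - pr (α + Real.pi / 2) b
  have h4 : p * q - p' * q' ≤ ‖z - a‖ * ‖z - b‖ := by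
    refine abs_le_of_sq_le_sq' ?_ (by positivity) |>.2
    rw [mul_pow, h1, h2]
    nlinarith [sq_nonneg (p * q' + q * p')]
  have h5 : pr α b - pr α a = p - q := by simp only [p, q]; ring
  have h6 : pr (α + Real.pi / 2) b - pr (α + Real.pi / 2) a = p' - q' := by simp only [p', q']; ring
  rw [h5, h6] at h3
  nlinarith [mul_le_mul hp hq hk (hk.trans hp)]

theorem le_half_sqrt_of_pr_le {α k l : ℝ} {a b z : Plane} (hl : ‖z - a‖ + ‖b - z‖ ≤ l)
    (ha : pr α a + k ≤ pr α z) (hb : pr α b + k ≤ pr α z) :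
    k ≤ Real.sqrt (l ^ 2 - ‖b - a‖ ^ 2) / 2 := by
  rcases le_or_gt k 0 with hk | hk
  · exact hk.trans (by positivity)
  · have h1 := sq_add_le_of_pr_le hk.le ha hb
    have h2 : (‖z - a‖ + ‖b - z‖) ^ 2 ≤ l ^ 2 := pow_le_pow_left₀ (by positivity) hl 2
    rw [le_div_iff₀ (by norm_num)]
    exact Real.le_sqrt_of_sq_le (by nlinarith)

/-- `S` lies in an ellipse with foci `a` and `b`, which overshoots the shadow of the chord by at
most its minor semi-axis on each side. -/
theorem volume_image_pr_diff_shadow_le {α l : ℝ} {a b : Plane} {S : Set Plane}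
    (hS : ∀ z ∈ S, ‖z - a‖ + ‖b - z‖ ≤ l) :
    volume (pr α '' S \ shadow α a (b - a)) ≤
      ENNReal.ofReal (Real.sqrt (l ^ 2 - ‖b - a‖ ^ 2)) := by
  set h := Real.sqrt (l ^ 2 - ‖b - a‖ ^ 2) / 2 with hh
  have hsub : pr α '' S \ shadow α a (b - a) ⊆
      Icc (max (pr α a) (pr α b)) (max (pr α a) (pr α b) + h) ∪
        Icc (min (pr α a) (pr α b) - h) (min (pr α a) (pr α b)) := by
    rintro _ ⟨⟨z, hz, rfl⟩, hn⟩
    rw [shadow, pr_sub, add_sub_cancel, uIcc, mem_Icc, not_and_or, not_le, not_le] at hn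
    rcases hn with hn | hn
    · right
      refine ⟨?_, hn.le⟩
      have := le_half_sqrt_of_pr_le (α := α + Real.pi)
        (k := min (pr α a) (pr α b) - pr α z) (hS z hz)
        (by rw [pr_add_pi, pr_add_pi]; linarith [min_le_left (pr α a) (pr α b)])
        (by rw [pr_add_pi, pr_add_pi]; linarith [min_le_right (pr α a) (pr α b)])
      linarith
    · left
      refine ⟨hn.le, ?_⟩
      have := le_half_sqrt_of_pr_le (α := α)
        (k := pr α z - max (pr α a) (pr α b)) (hS z hz)
        (by linarith [le_max_left (pr α a) (pr α b)])
        (by linarith [le_max_right (pr α a) (pr α b)])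
      linarith
  refine (measure_mono hsub).trans ((measure_union_le _ _).trans ?_)
  have h0 : 0 ≤ h := by rw [hh]; positivity
  rw [Real.volume_Icc, Real.volume_Icc, add_sub_cancel_left, sub_sub_cancel,
    ← ENNReal.ofReal_add h0 h0]
  refine ENNReal.ofReal_le_ofReal (le_of_eq ?_)
  rw [hh]; ring

theorem norm_add_norm_le_eVariationOn {γ : Curve} {x y t : unitInterval}
    (hf : eVariationOn γ (Icc x y) ≠ ∞) (ht : t ∈ Icc x y) :
    ‖γ t - γ x‖ + ‖γ y - γ t‖ ≤ (eVariationOn γ (Icc x y)).toReal := by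
  have h1 : eVariationOn γ (Icc x t) + eVariationOn γ (Icc t y) = eVariationOn γ (Icc x y) := by
    simpa using eVariationOn.Icc_add_Icc γ (s := univ) ht.1 ht.2 (mem_univ t)
  have h2 := eVariationOn.edist_le γ (s := Icc x t) ⟨ht.1, le_rfl⟩ ⟨le_rfl, ht.1⟩
  have h3 := eVariationOn.edist_le γ (s := Icc t y) ⟨ht.2, le_rfl⟩ ⟨le_rfl, ht.2⟩
  rw [← dist_eq_norm, ← dist_eq_norm, dist_edist, dist_edist, ← ENNReal.toReal_add
    (edist_ne_top _ _) (edist_ne_top _ _)]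
  exact ENNReal.toReal_mono hf (h1 ▸ add_le_add h2 h3)

theorem exists_partition {γ : Curve} (hf : γ.length ≠ ∞) {δ : ℝ} (hδ : 0 < δ) :
    ∃ (n : ℕ) (u : ℕ → unitInterval), Monotone u ∧ u 0 = 0 ∧ u n = 1 ∧
      γ.length.toReal - δ ≤ ∑ i ∈ Finset.range n, ‖γ (u (i + 1)) - γ (u i)‖ := by
  obtain ⟨n, u, hu, h⟩ : ∃ (n : ℕ) (u : ℕ → unitInterval), Monotone u ∧
      γ.length.toReal - δ ≤ ∑ i ∈ Finset.range n, ‖γ (u (i + 1)) - γ (u i)‖ := by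
    rcases le_or_gt γ.length.toReal δ with h | h
    · exact ⟨0, fun _ => 0, monotone_const, by simpa using h⟩
    · have h1 : ENNReal.ofReal (γ.length.toReal - δ) < γ.length := by
        rw [ENNReal.ofReal_lt_iff_lt_toReal (by linarith) hf]; linarith
      rw [Curve.length, eVariationOn, lt_iSup_iff] at h1
      obtain ⟨⟨n, u, hu, _⟩, h2⟩ := h1
      refine ⟨n, u, hu, ?_⟩
      rw [← ENNReal.ofReal_le_ofReal_iff (Finset.sum_nonneg fun _ _ => norm_nonneg _),
        ENNReal.ofReal_sum_of_nonneg fun _ _ => norm_nonneg _]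
      refine h2.le.trans (le_of_eq (Finset.sum_congr rfl fun i _ => ?_))
      rw [edist_dist, dist_eq_norm]
  -- The partition is padded with the endpoints `0` and `1`, which can only increase the sum.
  refine ⟨n + 2, fun i => if i = 0 then 0 else if i ≤ n + 1 then u (i - 1) else 1, ?_, by simp,
    by simp, ?_⟩
  · refine monotone_nat_of_le_succ fun i => ?_
    rcases Nat.eq_zero_or_pos i with rfl | hi
    · simp
    · by_cases h1 : i + 1 ≤ n + 1
      · have h2 : i ≤ n + 1 := by omega
        simp only [hi.ne', if_false, h2, h1, if_true, Nat.succ_ne_zero]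
        exact hu (by omega)
      · simp only [h1, if_false, Nat.succ_ne_zero]
        exact unitInterval.le_one _
  · rw [Finset.sum_range_succ, Finset.sum_range_succ']
    refine h.trans (le_trans (le_of_eq (Finset.sum_congr rfl fun i hi => ?_))
      ((le_add_of_nonneg_right (norm_nonneg _)).trans (le_add_of_nonneg_right (norm_nonneg _))))
    have hi := Finset.mem_range.1 hi
    have h1 : i + 1 + 1 ≤ n + 1 := by omega
    have h2 : i + 1 ≤ n + 1 := by omega
    simp only [Nat.succ_ne_zero, if_false, h1, h2, if_true, Nat.add_sub_cancel]

/-- An arc of length `L i` with chord `d i` leaves at most `√(L i ^ 2 - d i ^ 2)` uncovered, in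
every direction alike. By Cauchy–Schwarz these sum to at most `√(δ * 2 * l)`, whence the choice of
`δ`. -/
theorem exists_chords {γ : Curve} (hf : γ.length ≠ ∞) {ε : ℝ} (hε : 0 < ε) :
    ∃ (n : ℕ) (a v : Fin n → Plane), ∑ k, ‖v k‖ ≤ γ.length.toReal ∧
      ∀ α, volume (pr α '' range γ \ ⋃ k, shadow α (a k) (v k)) ≤ ENNReal.ofReal ε := by
  set l := γ.length.toReal with hl
  have hl0 : 0 ≤ l := ENNReal.toReal_nonneg
  set δ := ε ^ 2 / (2 * l + 1) with hδ
  have hδ0 : 0 < δ := by positivity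
  obtain ⟨n, u, hu, hu0, hun, hsum⟩ := exists_partition hf hδ0
  set L : ℕ → ℝ := fun i => (eVariationOn γ (Icc (u i) (u (i + 1)))).toReal with hL
  set d : ℕ → ℝ := fun i => ‖γ (u (i + 1)) - γ (u i)‖ with hd
  have hfi : ∀ i, eVariationOn γ (Icc (u i) (u (i + 1))) ≠ ∞ := fun i =>
    ne_top_of_le_ne_top hf (eVariationOn.mono γ (subset_univ _))
  have hdL : ∀ i, d i ≤ L i := fun i => by
    have := norm_add_norm_le_eVariationOn (hfi i) (left_mem_Icc.2 (hu (Nat.le_succ i)))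
    simpa using this
  have hLsum : ∑ i ∈ Finset.range n, L i = l := by
    rw [hL, hl, ← ENNReal.toReal_sum fun i _ => hfi i, eVariationOn.sum' γ hu, hu0, hun,
      Curve.length]
    congr 2
    exact eq_univ_of_forall fun t => ⟨unitInterval.nonneg', unitInterval.le_one'⟩
  have hbound : ∑ i ∈ Finset.range n, Real.sqrt (L i ^ 2 - d i ^ 2) ≤ ε := by
    have h1 := Real.sum_sqrt_mul_sqrt_le (Finset.range n) (f := fun i => L i - d i)
      (g := fun i => L i + d i) (fun i => by linarith [hdL i])
      (fun i => add_nonneg ENNReal.toReal_nonneg (norm_nonneg _))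
    have h2 : ∀ i, Real.sqrt (L i - d i) * Real.sqrt (L i + d i) =
        Real.sqrt (L i ^ 2 - d i ^ 2) := fun i => by
      rw [← Real.sqrt_mul (by linarith [hdL i])]; ring_nf
    simp only [h2] at h1
    refine h1.trans ?_
    rw [← Real.sqrt_mul (Finset.sum_nonneg fun i _ => by linarith [hdL i])]
    refine Real.sqrt_le_iff.2 ⟨hε.le, ?_⟩
    rw [Finset.sum_sub_distrib, Finset.sum_add_distrib, hLsum]
    have h3 : ∑ i ∈ Finset.range n, d i ≤ l := hLsum ▸ Finset.sum_le_sum fun i _ => hdL i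
    have h4 : δ * (2 * l + 1) = ε ^ 2 := by rw [hδ]; field_simp
    have h5 : 0 ≤ ∑ i ∈ Finset.range n, d i := Finset.sum_nonneg fun i _ => norm_nonneg _
    nlinarith
  refine ⟨n, fun k => γ (u k), fun k => γ (u (k + 1)) - γ (u k), ?_, fun α => ?_⟩
  · rw [Fin.sum_univ_eq_sum_range (fun i => ‖γ (u (i + 1)) - γ (u i)‖), ← hLsum]
    exact Finset.sum_le_sum fun i _ => hdL i
  · have hsub : pr α '' range γ \ ⋃ k : Fin n, shadow α (γ (u k)) (γ (u (k + 1)) - γ (u k)) ⊆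
        ⋃ i ∈ Finset.range n, (pr α '' (γ '' Icc (u i) (u (i + 1))) \
          shadow α (γ (u i)) (γ (u (i + 1)) - γ (u i))) := by
      rintro _ ⟨⟨_, ⟨t, rfl⟩, rfl⟩, hn⟩
      have ht : ∃ i < n, t ∈ Icc (u i) (u (i + 1)) := by
        by_contra! hcon
        have : ∀ i ≤ n, u i ≤ t := fun i => by
          induction i with
          | zero => intro _; rw [hu0]; exact unitInterval.nonneg'
          | succ i ih =>
            intro hi
            by_contra! hlt
            exact hcon i (by omega) ⟨ih (by omega), hlt.le⟩
        have h1 : t = 1 := le_antisymm unitInterval.le_one' (hun ▸ this n le_rfl)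
        rcases Nat.eq_zero_or_pos n with h0 | h0
        · subst h0
          rw [hu0] at hun
          exact zero_ne_one hun
        · exact hcon (n - 1) (by omega) ⟨this _ (by omega), by
            rw [Nat.sub_add_cancel h0, hun, h1]⟩
      obtain ⟨i, hi, hti⟩ := ht
      refine mem_biUnion (Finset.mem_coe.2 (Finset.mem_range.2 hi)) ⟨⟨_, ⟨t, hti, rfl⟩, rfl⟩, ?_⟩
      exact fun h => hn (mem_iUnion.2 ⟨⟨i, hi⟩, h⟩)
    refine (measure_mono hsub).trans ((measure_biUnion_finset_le _ _).trans ?_)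
    refine le_trans (Finset.sum_le_sum fun i _ => volume_image_pr_diff_shadow_le (l := L i) ?_) ?_
    · rintro _ ⟨t, ht, rfl⟩
      exact norm_add_norm_le_eVariationOn (hfi i) ht
    · rw [← ENNReal.ofReal_sum_of_nonneg fun _ _ => Real.sqrt_nonneg _]
      exact ENNReal.ofReal_le_ofReal hbound

theorem volume_image_pr_range_le (γ : Curve) (α : ℝ) : volume (pr α '' range γ) ≤ γ.length := by
  refine (Real.volume_le_diam _).trans (Metric.ediam_le ?_)
  rintro _ ⟨_, ⟨s, rfl⟩, rfl⟩ _ ⟨_, ⟨t, rfl⟩, rfl⟩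
  refine le_trans ?_ (eVariationOn.edist_le γ (mem_univ s) (mem_univ t))
  rw [edist_dist, edist_dist, Real.dist_eq, dist_eq_norm, ← pr_sub]
  exact ENNReal.ofReal_le_ofReal (abs_pr_le _ _)

/-- All but finitely many curves have small total length, hence small projections; the rest are
replaced by chords. -/
theorem exists_segments {B : Set Plane} {L : ℝ≥0} (hB : IsRectifiableWithLength B L) {ε : ℝ}
    (hε : 0 < ε) :
    ∃ (κ : Type) (_ : Fintype κ) (a v : κ → Plane), ∑ k, ‖v k‖ ≤ L ∧
      ∀ α, volume (pr α '' B \ ⋃ k, shadow α (a k) (v k)) ≤ ENNReal.ofReal ε := by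
  obtain ⟨ι, _, γ, rfl, -, hL⟩ := hB
  have hsum : ∑' i, (γ i).length ≠ ∞ := hL ▸ ENNReal.coe_ne_top
  have hfin : ∀ i, (γ i).length ≠ ∞ := fun i => ENNReal.ne_top_of_tsum_ne_top hsum i
  obtain ⟨F, hF⟩ : ∃ F : Finset ι, ∑' i : {i // i ∉ F}, (γ i).length ≤ ENNReal.ofReal (ε / 2) := by
    have := (ENNReal.tendsto_tsum_compl_atTop_zero hsum).eventually
      (Iic_mem_nhds (ENNReal.ofReal_pos.2 (half_pos hε)))
    exact this.exists
  have hc : ∀ i : F, ∃ (n : ℕ) (a v : Fin n → Plane), ∑ k, ‖v k‖ ≤ (γ i).length.toReal ∧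
      ∀ α, volume (pr α '' range (γ i) \ ⋃ k, shadow α (a k) (v k)) ≤
        ENNReal.ofReal (ε / 2 / (F.card + 1)) := fun i => exists_chords (hfin i) (by positivity)
  choose n a v hv hcov using hc
  refine ⟨Σ i : F, Fin (n i), inferInstance, fun p => a p.1 p.2, fun p => v p.1 p.2, ?_, fun α => ?_⟩
  · rw [Fintype.sum_sigma]
    refine (Finset.sum_le_sum fun i _ => hv i).trans ?_
    rw [Finset.sum_coe_sort F fun i => (γ i).length.toReal, ← ENNReal.toReal_sum fun i _ => hfin i,
      ← ENNReal.coe_toReal L, ← hL]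
    refine ENNReal.toReal_mono hsum ?_
    exact ENNReal.sum_le_tsum F
  · have hsub : pr α '' (⋃ i, range (γ i)) \
        ⋃ p : Σ i : F, Fin (n i), shadow α (a p.1 p.2) (v p.1 p.2) ⊆
        (⋃ i : F, (pr α '' range (γ i) \ ⋃ k, shadow α (a i k) (v i k))) ∪
          ⋃ i : {i // i ∉ F}, pr α '' range (γ i) := by
      rintro _ ⟨⟨z, hz, rfl⟩, hn⟩
      obtain ⟨i, hi⟩ := mem_iUnion.1 hz
      by_cases h : i ∈ F
      · refine Or.inl (mem_iUnion.2 ⟨⟨i, h⟩, ⟨z, hi, rfl⟩, fun h' => hn ?_⟩)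
        obtain ⟨k, hk⟩ := mem_iUnion.1 h'
        exact mem_iUnion.2 ⟨⟨⟨i, h⟩, k⟩, hk⟩
      · exact Or.inr (mem_iUnion.2 ⟨⟨i, h⟩, ⟨z, hi, rfl⟩⟩)
    refine (measure_mono hsub).trans ((measure_union_le _ _).trans ?_)
    have h1 : volume (⋃ i : F, (pr α '' range (γ i) \ ⋃ k, shadow α (a i k) (v i k))) ≤
        ENNReal.ofReal (ε / 2) := by
      refine (measure_iUnion_fintype_le _ _).trans
        ((Finset.sum_le_sum fun i _ => hcov i α).trans ?_)
      rw [← ENNReal.ofReal_sum_of_nonneg fun _ _ => by positivity]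
      refine ENNReal.ofReal_le_ofReal ?_
      rw [Finset.sum_const, Finset.card_univ, Fintype.card_coe, nsmul_eq_mul, mul_div_assoc',
        div_le_iff₀ (by positivity)]
      nlinarith
    have h2 : volume (⋃ i : {i // i ∉ F}, pr α '' range (γ i)) ≤ ENNReal.ofReal (ε / 2) :=
      (measure_iUnion_le _).trans
        ((ENNReal.tsum_le_tsum fun i : {i // i ∉ F} => volume_image_pr_range_le (γ i) α).trans hF)
    refine (add_le_add h1 h2).trans (le_of_eq ?_)
    rw [← ENNReal.ofReal_add (by positivity) (by positivity), add_halves]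

/-! ### Cutting segments into pieces of equal length -/

theorem pr_mem_uIcc (α : ℝ) (a v : Plane) {c d s : ℝ} (h : s ∈ Icc c d) :
    pr α (a + s • v) ∈ uIcc (pr α (a + c • v)) (pr α (a + d • v)) := by
  simp only [pr_add, pr_smul, mem_uIcc]
  rcases le_total 0 (pr α v) with hv | hv
  · left; constructor <;> nlinarith [h.1, h.2]
  · right; constructor <;> nlinarith [h.1, h.2]

theorem volume_shadow_diff_pieces_le {α σ : ℝ} (hσ : 0 < σ) (a v : Plane) :
    volume (shadow α a v \ ⋃ j : Fin ⌊‖v‖ / σ⌋₊,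
      shadow α (a + ((j : ℝ) * (σ / ‖v‖)) • v) ((σ / ‖v‖) • v)) ≤ ENNReal.ofReal σ := by
  set m := ⌊‖v‖ / σ⌋₊ with hm
  set c := (m : ℝ) * (σ / ‖v‖) with hc
  have hsub : shadow α a v \ ⋃ j : Fin m,
      shadow α (a + ((j : ℝ) * (σ / ‖v‖)) • v) ((σ / ‖v‖) • v) ⊆
      uIcc (pr α (a + c • v)) (pr α (a + (1 : ℝ) • v)) := by
    rintro t ⟨ht, hn⟩
    obtain ⟨s, hs, rfl⟩ := exists_of_mem_shadow ht
    rcases le_or_gt c s with h | h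
    · exact pr_mem_uIcc α a v ⟨h, hs.2⟩
    · exfalso
      -- For `v = 0` division by zero makes `c = 0`, and no `s ≥ 0` lies below it.
      have hv : 0 < ‖v‖ := by
        rcases (norm_nonneg v).eq_or_lt with h0 | h0
        · rw [hc, ← h0, div_zero, mul_zero] at h
          exact absurd hs.1 (not_le.2 h)
        · exact h0
      have hw : 0 < σ / ‖v‖ := by positivity
      have hj : ⌊s / (σ / ‖v‖)⌋₊ < m := by
        rw [Nat.floor_lt (div_nonneg hs.1 hw.le), div_lt_iff₀ hw]
        exact h
      refine hn (mem_iUnion.2 ⟨⟨_, hj⟩, ?_⟩)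
      have h1 := Nat.floor_le (div_nonneg hs.1 hw.le)
      have h2 := (Nat.lt_floor_add_one (s / (σ / ‖v‖))).le
      rw [le_div_iff₀ hw] at h1
      rw [div_le_iff₀ hw] at h2
      have := pr_mem_uIcc α a v (c := (⌊s / (σ / ‖v‖)⌋₊ : ℝ) * (σ / ‖v‖))
        (d := ((⌊s / (σ / ‖v‖)⌋₊ : ℝ) + 1) * (σ / ‖v‖)) ⟨h1, h2⟩
      rwa [add_one_mul, add_smul, ← add_assoc, pr_add α (a + _) ((σ / ‖v‖) • v)] at this
  refine (measure_mono hsub).trans ?_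
  rw [Real.volume_interval, ← pr_sub, add_sub_add_left_eq_sub, ← sub_smul, pr_smul, abs_mul]
  refine ENNReal.ofReal_le_ofReal ?_
  rcases (norm_nonneg v).eq_or_lt with h0 | h0
  · have : v = 0 := norm_eq_zero.1 h0.symm
    simp [this, pr, hσ.le]
  · have h1 : c * ‖v‖ = m * σ := by rw [hc]; field_simp
    have h2 : (m : ℝ) * σ ≤ ‖v‖ := by
      have := Nat.floor_le (div_nonneg (norm_nonneg v) hσ.le)
      rwa [le_div_iff₀ hσ] at this
    have h3 : ‖v‖ ≤ (m + 1) * σ := by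
      have := (Nat.lt_floor_add_one (‖v‖ / σ)).le
      rwa [div_le_iff₀ hσ] at this
    have hc1 : c ≤ 1 := by
      rw [← mul_le_mul_iff_left₀ h0]; linarith
    rw [abs_of_nonneg (by linarith)]
    refine (mul_le_mul_of_nonneg_left (abs_pr_le α v) (by linarith)).trans ?_
    linarith

/-- A common length lets the crossing argument use intervals of one width. Each original segment
loses a remainder of length at most `σ`, and `σ` is small against their number. -/
theorem exists_equal_segments {B : Set Plane} {L : ℝ≥0} (hB : IsRectifiableWithLength B L) {τ σ₀ : ℝ}
    (hτ : 0 < τ) (hσ₀ : 0 < σ₀) :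
    ∃ (N : ℕ) (a v : Fin N → Plane) (σ : ℝ), 0 < σ ∧ σ ≤ σ₀ ∧ (∀ k, ‖v k‖ = σ) ∧ N * σ ≤ L ∧
      ∀ α, volume (pr α '' B \ ⋃ k, shadow α (a k) (v k)) ≤ ENNReal.ofReal τ := by
  obtain ⟨κ, _, a, v, hL, hcov⟩ := exists_segments hB (half_pos hτ)
  obtain ⟨σ, hσ, hσ1, hσ2⟩ : ∃ σ : ℝ, 0 < σ ∧ σ ≤ σ₀ ∧ Fintype.card κ * σ ≤ τ / 2 := by
    refine ⟨min σ₀ (τ / 2 / (Fintype.card κ + 1)), by positivity, min_le_left _ _, ?_⟩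
    refine (mul_le_mul_of_nonneg_left (min_le_right _ _) (by positivity)).trans ?_
    rw [mul_div_assoc', div_le_iff₀ (by positivity)]
    nlinarith
  set m : κ → ℕ := fun k => ⌊‖v k‖ / σ⌋₊ with hm
  let eq := (Fintype.equivFin (Σ k, Fin (m k))).symm
  let a' : (Σ k, Fin (m k)) → Plane := fun p => a p.1 + ((p.2 : ℝ) * (σ / ‖v p.1‖)) • v p.1
  let v' : (Σ k, Fin (m k)) → Plane := fun p => (σ / ‖v p.1‖) • v p.1
  refine ⟨Fintype.card (Σ k, Fin (m k)), a' ∘ eq, v' ∘ eq, σ, hσ, hσ1, fun k => ?_, ?_, fun α => ?_⟩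
  · have hv : ‖v (eq k).1‖ ≠ 0 := fun h0 => by
      have hlt := (eq k).2.2
      simp [hm, h0] at hlt
    simp only [Function.comp_apply, v']
    rw [norm_smul, Real.norm_of_nonneg (by positivity), div_mul_cancel₀ _ hv]
  · rw [Fintype.card_sigma]
    push_cast
    rw [Finset.sum_mul]
    refine (Finset.sum_le_sum fun k _ => ?_).trans hL
    rw [Fintype.card_fin]
    have := Nat.floor_le (div_nonneg (norm_nonneg (v k)) hσ.le)
    rwa [le_div_iff₀ hσ] at this
  · have hsub : pr α '' B \ ⋃ k, shadow α ((a' ∘ eq) k) ((v' ∘ eq) k) ⊆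
        (pr α '' B \ ⋃ k, shadow α (a k) (v k)) ∪ ⋃ k, (shadow α (a k) (v k) \
          ⋃ j : Fin (m k), shadow α (a k + ((j : ℝ) * (σ / ‖v k‖)) • v k) ((σ / ‖v k‖) • v k)) := by
      rintro t ⟨ht, hn⟩
      by_cases h : t ∈ ⋃ k, shadow α (a k) (v k)
      · obtain ⟨k, hk⟩ := mem_iUnion.1 h
        refine Or.inr (mem_iUnion.2 ⟨k, hk, fun h' => hn ?_⟩)
        obtain ⟨j, hj⟩ := mem_iUnion.1 h'
        refine mem_iUnion.2 ⟨eq.symm ⟨k, j⟩, ?_⟩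
        simpa only [Function.comp_apply, Equiv.apply_symm_apply] using hj
      · exact Or.inl ⟨ht, h⟩
    refine (measure_mono hsub).trans ((measure_union_le _ _).trans ?_)
    have h2 := (measure_iUnion_fintype_le volume fun k => shadow α (a k) (v k) \
          ⋃ j : Fin (m k), shadow α (a k + ((j : ℝ) * (σ / ‖v k‖)) • v k) ((σ / ‖v k‖) • v k)).trans
        (Finset.sum_le_sum fun k _ => volume_shadow_diff_pieces_le hσ (a k) (v k))
    refine (add_le_add (hcov α) h2).trans ?_
    rw [Finset.sum_const, Finset.card_univ, ← ENNReal.ofReal_nsmul, nsmul_eq_mul,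
      ← ENNReal.ofReal_add (by positivity) (by positivity)]
    exact ENNReal.ofReal_le_ofReal (by linarith)

theorem volume_image_pr_le_length {B : Set Plane} {L : ℝ≥0} (hB : IsRectifiableWithLength B L)
    (α : ℝ) : volume (pr α '' B) ≤ L := by
  obtain ⟨ι, _, γ, rfl, -, hL⟩ := hB
  rw [image_iUnion, ← hL]
  exact (measure_iUnion_le _).trans (ENNReal.tsum_le_tsum fun i => volume_image_pr_range_le (γ i) α)

/-! ### Barriers -/

theorem IsBarrier.image_pr_subset {B U : Set Plane} (h : IsBarrier B U) (α : ℝ) :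
    pr α '' U ⊆ pr α '' B := by
  rintro _ ⟨u, hu, rfl⟩
  have hdir : dir (α + Real.pi / 2) ≠ 0 := by
    rw [← norm_ne_zero_iff, norm_dir]; exact one_ne_zero
  obtain ⟨x, hx, hxB⟩ := h (AffineSubspace.mk' u (Submodule.span ℝ {dir (α + Real.pi / 2)}))
    (by rw [AffineSubspace.direction_mk', finrank_span_singleton hdir])
    ⟨u, AffineSubspace.self_mem_mk' _ _, hu⟩
  refine ⟨x, hxB, ?_⟩
  rw [SetLike.mem_coe, AffineSubspace.mem_mk', Submodule.mem_span_singleton] at hx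
  obtain ⟨c, hc⟩ := hx
  have h1 : pr α (x - u) = 0 := by
    rw [← vsub_eq_sub, ← hc, pr_smul, pr_dir]
    simp
  rw [pr_sub] at h1
  linarith

/-- Two points of `U` farther apart than `L` would force a projection of `B` of measure greater than
`L`. -/
theorem not_isBarrier_of_not_isBounded {B U : Set Plane} {L : ℝ≥0} (hc : Convex ℝ U)
    (hU : ¬ Bornology.IsBounded U) (hB : IsRectifiableWithLength B L) : ¬ IsBarrier B U := by
  intro hbar
  rw [Metric.isBounded_iff] at hU
  push Not at hU
  obtain ⟨x, hx, y, hy, hxy⟩ := hU L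
  obtain ⟨α, -, hα⟩ := exists_eq_smul_dir (y - x)
  have hpr : pr α y - pr α x = ‖y - x‖ := by
    rw [← pr_sub, hα, pr_smul, pr_dir]
    simp [norm_smul, norm_dir]
  have hsub : Icc (pr α x) (pr α y) ⊆ pr α '' U :=
    (hc.isPreconnected.image _ (continuous_pr_right α).continuousOn).Icc_subset
      ⟨x, hx, rfl⟩ ⟨y, hy, rfl⟩
  have h1 := (measure_mono (hsub.trans (hbar.image_pr_subset α))).trans
    (volume_image_pr_le_length hB α)
  rw [Real.volume_Icc, hpr, ENNReal.ofReal_le_iff_le_toReal ENNReal.coe_ne_top,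
    ENNReal.coe_toReal, ← dist_eq_norm, dist_comm] at h1
  linarith

open Measure

/-! ### The perimeter is at most the integral of the support function -/

section Perimeter
variable {U : Set Plane}

theorem exists_eq_mul_pr (f : StrongDual ℝ Plane) :
    ∃ r, 0 ≤ r ∧ ∃ α, ∀ x, f x = r * pr α x := by
  obtain ⟨α, -, hα⟩ := exists_eq_smul_dir ((InnerProductSpace.toDual ℝ Plane).symm f)
  refine ⟨‖(InnerProductSpace.toDual ℝ Plane).symm f‖, norm_nonneg _, α, fun x => ?_⟩
  rw [← inner_smul_dir, ← hα, InnerProductSpace.toDual_symm_apply]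

theorem exists_normal_of_mem_frontier (hc : Convex ℝ U)
    (hint : (interior U).Nonempty) {u : Plane} (hu : u ∈ frontier U) :
    ∃ β, ∀ x ∈ U, pr β x ≤ pr β u := by
  obtain ⟨f, hf⟩ := geometric_hahn_banach_open_point hc.interior isOpen_interior
    (fun h : u ∈ interior U => hu.2 h)
  obtain ⟨r, hr, β, hfr⟩ := exists_eq_mul_pr f
  obtain ⟨w, hw⟩ := hint
  have hr0 : 0 < r := by
    refine hr.lt_of_ne fun h => ?_
    have := hf w hw
    rw [hfr, hfr, ← h] at this
    simp at this
  refine ⟨β, fun x hx => ?_⟩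
  have hcl : x ∈ closure (interior U) := by
    rw [hc.closure_interior_eq_closure_of_nonempty_interior ⟨w, hw⟩]
    exact subset_closure hx
  refine closure_minimal (t := {x | pr β x ≤ pr β u}) (fun z hz => ?_)
    (isClosed_le (continuous_pr_right β) continuous_const) hcl
  have := hf z hz
  rw [hfr, hfr] at this
  exact (lt_of_mul_lt_mul_left this hr).le

/-- Moving boundary points along outer normals does not shrink distances: the displacements add a
nonnegative amount to the inner product with `u - u'`. -/
theorem norm_sub_le_of_normals {u u' : Plane} {β β' t t' : ℝ} (ht : 0 ≤ t) (ht' : 0 ≤ t')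
    (h : pr β u' ≤ pr β u) (h' : pr β' u ≤ pr β' u') :
    ‖u - u'‖ ≤ ‖(u + t • dir β) - (u' + t' • dir β')‖ := by
  set w := u - u' with hw
  set z := (u + t • dir β) - (u' + t' • dir β') with hz
  have h1 : inner ℝ z w = ‖w‖ ^ 2 + t * pr β w - t' * pr β' w := by
    have : z = w + t • dir β - t' • dir β' := by rw [hz, hw]; abel
    rw [this, inner_sub_left, inner_add_left, inner_smul_dir, inner_smul_dir,
      real_inner_self_eq_norm_sq]
  have h2 : 0 ≤ t * pr β w := mul_nonneg ht (by rw [hw, pr_sub]; linarith)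
  have h3 : t' * pr β' w ≤ 0 := mul_nonpos_of_nonneg_of_nonpos ht' (by rw [hw, pr_sub]; linarith)
  have h4 := real_inner_le_norm z w
  by_contra! hlt
  nlinarith [norm_nonneg z, norm_nonneg w]

theorem exists_cos_pos {m : ℕ} (hm : 5 ≤ m) (θ β : ℝ) :
    ∃ i < m, 0 < Real.cos (θ + i * (2 * Real.pi / m) - β) := by
  have hpi := Real.pi_pos
  have hm0 : (0 : ℝ) < m := by positivity
  set φ := 2 * Real.pi / m with hφ
  have hφ0 : 0 < φ := by positivity
  have hφm : m * φ = 2 * Real.pi := by rw [hφ]; field_simp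
  have hφ1 : φ < Real.pi / 2 := by
    have : (5 : ℝ) ≤ m := by exact_mod_cast hm
    nlinarith
  set y := (β - θ) / (2 * Real.pi) with hy
  set x := 2 * Real.pi * Int.fract y with hx
  have hx0 : 0 ≤ x := mul_nonneg (by positivity) (Int.fract_nonneg y)
  have hx1 : x < m * φ := by
    rw [hφm, hx]
    exact mul_lt_of_lt_one_right (by positivity) (Int.fract_lt_one y)
  have hxe : β - θ = x + ⌊y⌋ * (2 * Real.pi) := by
    have h1 : β - θ = 2 * Real.pi * y := by rw [hy]; field_simp
    rw [h1, hx, ← Int.self_sub_floor]; ring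
  refine ⟨⌊x / φ⌋₊, ?_, ?_⟩
  · rw [Nat.floor_lt (by positivity), div_lt_iff₀ hφ0]; exact hx1
  · have h1 := Nat.floor_le (div_nonneg hx0 hφ0.le)
    have h2 := Nat.lt_floor_add_one (x / φ)
    rw [le_div_iff₀ hφ0] at h1
    rw [div_lt_iff₀ hφ0] at h2
    rw [show θ + ⌊x / φ⌋₊ * φ - β = (⌊x / φ⌋₊ * φ - x) - ⌊y⌋ * (2 * Real.pi) by linarith,
      Real.cos_sub_int_mul_two_pi]
    exact Real.cos_pos_of_mem_Ioo ⟨by linarith, by linarith⟩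

/-- The face with outer normal angle `ψ` of a circumscribed equiangular polygon with exterior
angle `φ`. -/
def face (U : Set Plane) (φ ψ : ℝ) : Set Plane :=
  {z | pr ψ z = supp U ψ ∧ pr (ψ + φ) z ≤ supp U (ψ + φ) ∧ pr (ψ - φ) z ≤ supp U (ψ - φ)}

/-- The ray from `u` leaves the circumscribed polygon through the face line it reaches first, which
minimises `T` among the normals with positive `C`. -/
theorem exists_mem_face (hU : IsCompact U) {m : ℕ} (hm : 5 ≤ m) (θ β : ℝ) {u : Plane}
    (hu : u ∈ U) : ∃ t : ℝ, 0 ≤ t ∧ ∃ i < m,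
      u + t • dir β ∈ face U (2 * Real.pi / m) (θ + i * (2 * Real.pi / m)) := by
  classical
  have hm0 : (m : ℝ) ≠ 0 := by positivity
  set φ := 2 * Real.pi / m with hφ
  have hφm : m * φ = 2 * Real.pi := by rw [hφ]; field_simp
  set C : ℕ → ℝ := fun i => Real.cos (θ + i * φ - β)
  set T : ℕ → ℝ := fun i => (supp U (θ + i * φ) - pr (θ + i * φ) u) / C i with hT
  obtain ⟨i₀, hi₀, hc₀⟩ := exists_cos_pos hm θ β
  obtain ⟨i, hi, hmin⟩ := Finset.exists_min_image ((Finset.range m).filter fun i => 0 < C i) T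
    ⟨i₀, by simp [hi₀]; exact hc₀⟩
  simp only [Finset.mem_filter, Finset.mem_range] at hi hmin
  have hpr : ∀ j : ℕ, pr (θ + j * φ) (u + T i • dir β) = pr (θ + j * φ) u + T i * C j := fun j => by
    rw [pr_add, pr_smul, pr_dir]
  have hT0 : 0 ≤ T i := div_nonneg (by linarith [pr_le_supp hU (θ + i * φ) hu]) hi.2.le
  have hle : ∀ j < m, pr (θ + j * φ) (u + T i • dir β) ≤ supp U (θ + j * φ) := fun j hj => by
    rw [hpr]
    rcases le_or_gt (C j) 0 with h | h
    · have h1 := mul_nonpos_of_nonneg_of_nonpos hT0 h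
      linarith [pr_le_supp hU (θ + j * φ) hu]
    · have h1 := hmin j ⟨hj, h⟩
      rw [hT, le_div_iff₀ h] at h1
      linarith
  refine ⟨T i, hT0, i, hi.1, ?_, ?_, ?_⟩
  · rw [hpr, hT, div_mul_cancel₀ _ hi.2.ne']; ring
  · rcases Nat.lt_or_ge (i + 1) m with h | h
    · have := hle (i + 1) h
      rw [show θ + i * φ + φ = θ + (i + 1 : ℕ) * φ by push_cast; ring]
      exact this
    · have hi' : i + 1 = m := by omega
      have h1 := hle 0 (by omega)
      have h2 : θ + i * φ + φ = θ + (0 : ℕ) * φ + 2 * Real.pi := by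
        rw [← hφm, ← hi']; push_cast; ring
      rw [h2, supp_periodic U, pr_add_two_pi]
      exact h1
  · rcases Nat.eq_zero_or_pos i with h | h
    · have h1 := hle (m - 1) (by omega)
      have h2 : θ + (m - 1 : ℕ) * φ = θ + i * φ - φ + 2 * Real.pi := by
        rw [← hφm, h, Nat.cast_sub (by omega)]; push_cast; ring
      rw [h2, supp_periodic U, pr_add_two_pi] at h1
      exact h1
    · have h1 := hle (i - 1) (by omega)
      rw [show θ + i * φ - φ = θ + (i - 1 : ℕ) * φ by rw [Nat.cast_sub h]; push_cast; ring]
      exact h1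

/-- The length of a face of a circumscribed equiangular polygon. -/
noncomputable def faceLength (U : Set Plane) (φ ψ : ℝ) : ℝ :=
  (supp U (ψ + φ) + supp U (ψ - φ) - 2 * Real.cos φ * supp U ψ) / Real.sin φ

theorem faceLength_nonneg (hU : IsCompact U) (hne : U.Nonempty) {φ : ℝ} (hφ : 0 < Real.sin φ)
    (ψ : ℝ) : 0 ≤ faceLength U φ ψ := by
  obtain ⟨u, hu, h⟩ := exists_pr_eq_supp hU hne ψ
  refine div_nonneg ?_ hφ.le
  have h1 := pr_le_supp hU (ψ + φ) hu
  have h2 := pr_le_supp hU (ψ - φ) hu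
  have h3 : pr (ψ + φ) u + pr (ψ - φ) u = 2 * Real.cos φ * pr ψ u := by
    simp only [pr, Real.cos_add, Real.cos_sub, Real.sin_add, Real.sin_sub]; ring
  rw [← h]; linarith

theorem eq_pr_smul_dir_add (ψ : ℝ) (z : Plane) :
    z = pr ψ z • dir ψ + pr (ψ + Real.pi / 2) z • dir (ψ + Real.pi / 2) := by
  have := Real.sin_sq_add_cos_sq ψ
  ext i
  fin_cases i
  · simp [pr, Real.cos_add_pi_div_two, Real.sin_add_pi_div_two]
    linear_combination (-z 0) * this
  · simp [pr, Real.cos_add_pi_div_two, Real.sin_add_pi_div_two]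
    linear_combination (-z 1) * this

theorem hausdorffMeasure_face_le {φ : ℝ} (hφ : 0 < Real.sin φ) (ψ : ℝ) :
    μH[1] (face U φ ψ) ≤ ENNReal.ofReal (faceLength U φ ψ) := by
  set f : ℝ → Plane := fun x => supp U ψ • dir ψ + x • dir (ψ + Real.pi / 2)
  have hf : LipschitzWith 1 f := LipschitzWith.of_dist_le_mul fun x y => by
    simp only [f, dist_eq_norm, add_sub_add_left_eq_sub, ← sub_smul, norm_smul, norm_dir]
    simp
  have hsub : face U φ ψ ⊆ f '' Icc (-((supp U (ψ - φ) - supp U ψ * Real.cos φ) / Real.sin φ))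
      ((supp U (ψ + φ) - supp U ψ * Real.cos φ) / Real.sin φ) := by
    rintro z ⟨h0, h1, h2⟩
    refine ⟨pr (ψ + Real.pi / 2) z, ?_, ?_⟩
    · have hz := eq_pr_smul_dir_add ψ z
      rw [hz, pr_add, pr_smul, pr_smul, pr_dir, pr_dir, h0,
        show ψ + φ - ψ = φ by ring, show ψ + φ - (ψ + Real.pi / 2) = φ - Real.pi / 2 by ring,
        Real.cos_sub_pi_div_two] at h1
      rw [hz, pr_add, pr_smul, pr_smul, pr_dir, pr_dir, h0, show ψ - φ - ψ = -φ by ring,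
        show ψ - φ - (ψ + Real.pi / 2) = -φ - Real.pi / 2 by ring,
        Real.cos_sub_pi_div_two, Real.cos_neg, Real.sin_neg] at h2
      constructor
      · rw [neg_le, le_div_iff₀ hφ]; linarith
      · rw [le_div_iff₀ hφ]; linarith
    · simp only [f]
      rw [← h0]
      exact (eq_pr_smul_dir_add ψ z).symm
  refine (measure_mono hsub).trans ((hf.hausdorffMeasure_image_le zero_le_one _).trans ?_)
  rw [hausdorffMeasure_real, Real.volume_Icc]
  simp only [ENNReal.coe_one, ENNReal.one_rpow, one_mul]
  refine ENNReal.ofReal_le_ofReal (le_of_eq ?_)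
  rw [faceLength]; ring

theorem sum_faceLength (U : Set Plane) {m : ℕ} (hm : 0 < m) (θ : ℝ) :
    ∑ i ∈ Finset.range m, faceLength U (2 * Real.pi / m) (θ + i * (2 * Real.pi / m)) =
      (2 - 2 * Real.cos (2 * Real.pi / m)) / Real.sin (2 * Real.pi / m) *
        ∑ i ∈ Finset.range m, supp U (θ + i * (2 * Real.pi / m)) := by
  have hm0 : (m : ℝ) ≠ 0 := by positivity
  set φ := 2 * Real.pi / m with hφ
  have hφm : m * φ = 2 * Real.pi := by rw [hφ]; field_simp
  have hshift : ∀ θ, ∑ i ∈ Finset.range m, supp U (θ + i * φ + φ) =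
      ∑ i ∈ Finset.range m, supp U (θ + i * φ) := fun θ => by
    have h1 := Finset.sum_range_succ (fun i : ℕ => supp U (θ + i * φ)) m
    have h2 := Finset.sum_range_succ' (fun i : ℕ => supp U (θ + i * φ)) m
    rw [h1, hφm, supp_periodic U] at h2
    simp only [Nat.cast_zero, zero_mul, add_zero] at h2
    rw [add_right_cancel h2]
    exact Finset.sum_congr rfl fun i _ => by push_cast; ring_nf
  have h1 := hshift θ
  have h2 := hshift (θ - φ)
  have h3 : ∀ i : ℕ, θ - φ + i * φ + φ = θ + i * φ := fun i => by ring
  have h4 : ∀ i : ℕ, θ - φ + i * φ = θ + i * φ - φ := fun i => by ring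
  simp only [h3] at h2
  simp only [h4] at h2
  simp only [faceLength]
  rw [← Finset.sum_div, Finset.sum_sub_distrib, Finset.sum_add_distrib, h1, ← h2,
    ← Finset.mul_sum]
  ring

/-- Pushing each boundary point along an outer normal to the polygon does not decrease distances, so
the boundary is no longer than the polygon. -/
theorem hausdorffMeasure_frontier_le_sum (hU : IsCompact U) (hc : Convex ℝ U)
    (hint : (interior U).Nonempty) {m : ℕ} (hm : 5 ≤ m) (θ : ℝ) :
    μH[1] (frontier U) ≤ ENNReal.ofReal ((2 - 2 * Real.cos (2 * Real.pi / m)) /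
      Real.sin (2 * Real.pi / m) * ∑ i ∈ Finset.range m, supp U (θ + i * (2 * Real.pi / m))) := by
  have hne : U.Nonempty := hint.mono interior_subset
  have hsin : 0 < Real.sin (2 * Real.pi / m) := by
    have : (5 : ℝ) ≤ m := by exact_mod_cast hm
    refine Real.sin_pos_of_pos_of_lt_pi (by positivity) ?_
    rw [div_lt_iff₀ (by positivity)]
    nlinarith [Real.pi_pos]
  choose β hβ using fun u : frontier U => exists_normal_of_mem_frontier hc hint u.2
  have hmem : ∀ u : frontier U, (u : Plane) ∈ U := fun u => hU.isClosed.frontier_subset u.2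
  choose t ht i hi hz using fun u : frontier U => exists_mem_face hU hm θ (β u) (hmem u)
  set z : frontier U → Plane := fun u => u + t u • dir (β u)
  have hanti : AntilipschitzWith 1 z := AntilipschitzWith.of_le_mul_dist fun u u' => by
    rw [NNReal.coe_one, one_mul, Subtype.dist_eq, dist_eq_norm, dist_eq_norm]
    exact norm_sub_le_of_normals (ht u) (ht u') (hβ u _ (hmem u')) (hβ u' _ (hmem u))
  have h1 := hanti.le_hausdorffMeasure_image zero_le_one (univ : Set (frontier U))
  have h2 := (isometry_subtype_coe (s := frontier U)).hausdorffMeasure_image (d := 1)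
    (Or.inl zero_le_one) univ
  rw [image_univ, Subtype.range_coe] at h2
  rw [image_univ] at h1
  refine (h2.trans_le h1).trans ?_
  simp only [ENNReal.coe_one, ENNReal.one_rpow, one_mul]
  have hsub : range z ⊆ ⋃ i ∈ Finset.range m,
      face U (2 * Real.pi / m) (θ + i * (2 * Real.pi / m)) := by
    rintro _ ⟨u, rfl⟩
    exact mem_biUnion (Finset.mem_coe.2 (Finset.mem_range.2 (hi u))) (hz u)
  rw [← sum_faceLength U (by omega), ENNReal.ofReal_sum_of_nonneg fun _ _ =>
    faceLength_nonneg hU hne hsin _]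
  exact (measure_mono hsub).trans ((measure_biUnion_finset_le _ _).trans
    (Finset.sum_le_sum fun i _ => hausdorffMeasure_face_le hsin _))

theorem perimeter_le_integral_supp (hU : IsCompact U) (hc : Convex ℝ U)
    (hint : (interior U).Nonempty) :
    (perimeter U).toReal ≤ ∫ α in (0 : ℝ)..(2 * Real.pi), supp U α := by
  have hne : U.Nonempty := hint.mono interior_subset
  have hcs := continuous_supp hU hne
  set I := ∫ α in (0 : ℝ)..(2 * Real.pi), supp U α
  set P := (perimeter U).toReal with hP
  have hP0 : 0 ≤ P := ENNReal.toReal_nonneg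
  have hI : 0 ≤ I := by
    have h1 := integral_width hU hne
    have h2 : 0 ≤ ∫ α in (-(2 * Real.pi))..(2 * Real.pi), width U α :=
      intervalIntegral.integral_nonneg (by linarith [Real.pi_pos]) fun α _ => by
        rw [← volume_real_image_pr hU hc hne]; exact measureReal_nonneg
    linarith
  have key : ∀ m : ℕ, 7 ≤ m → P * (1 - (2 * Real.pi / m) ^ 2 / 4) ≤ I := by
    intro m hm
    have hm0 : (0 : ℝ) < m := by positivity
    have hm7 : (7 : ℝ) ≤ m := by exact_mod_cast hm
    have hbound := hausdorffMeasure_frontier_le_sum hU hc hint (m := m) (by omega)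
    set φ := 2 * Real.pi / m with hφ
    have hφm : m * φ = 2 * Real.pi := by rw [hφ]; field_simp
    have hφ0 : 0 < φ := by have := Real.pi_pos; positivity
    have hφ1 : φ ≤ 1 := by
      rw [hφ, div_le_one hm0]
      linarith [Real.pi_lt_d2]
    have hsin := Real.sin_gt_sub_cube hφ0
    have hsin0 : 0 < Real.sin φ := Real.sin_pos_of_pos_of_lt_pi hφ0 (by linarith [Real.pi_gt_three])
    have hcos := Real.one_sub_sq_div_two_le_cos (x := φ)
    have hcos1 := Real.cos_le_one φ
    set c := (2 - 2 * Real.cos φ) / Real.sin φ with hc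
    have hpt : ∀ θ, P ≤ c * ∑ i ∈ Finset.range m, supp U (θ + i * φ) := fun θ => by
      have h0 : 0 ≤ c * ∑ i ∈ Finset.range m, supp U (θ + i * φ) := by
        rw [← sum_faceLength U (by omega)]
        exact Finset.sum_nonneg fun _ _ => faceLength_nonneg hU hne hsin0 _
      exact ENNReal.toReal_le_of_le_ofReal h0 (hbound θ)
    have hcont : ∀ i : ℕ, Continuous fun θ => supp U (θ + i * φ) := fun i => by fun_prop
    -- Averaging over rotations `θ` in `[0, φ]` turns the sum of support values into the full
    -- integral, avoiding any limit of Riemann sums; only `c / φ` still has to tend to `1`.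
    have hint : φ * P ≤ c * I := by
      have h1 := intervalIntegral.integral_mono_on (μ := volume) (a := 0) (b := φ) hφ0.le
        (f := fun _ => P) (g := fun θ => c * ∑ i ∈ Finset.range m, supp U (θ + i * φ)) (by simp)
        ((by fun_prop : Continuous fun θ =>
          c * ∑ i ∈ Finset.range m, supp U (θ + i * φ)).intervalIntegrable _ _) fun θ _ => hpt θ
      rw [intervalIntegral.integral_const, sub_zero, smul_eq_mul,
        intervalIntegral.integral_const_mul,
        intervalIntegral.integral_finsetSum fun i _ => (hcont i).intervalIntegrable _ _] at h1
      refine h1.trans (le_of_eq ?_)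
      congr 1
      have h2 := intervalIntegral.sum_integral_adjacent_intervals (f := supp U) (μ := volume)
        (a := fun i : ℕ => i * φ) (n := m) fun i _ => hcs.intervalIntegrable _ _
      rw [hφm, Nat.cast_zero, zero_mul] at h2
      refine Eq.trans (Finset.sum_congr rfl fun i _ => ?_) h2
      rw [intervalIntegral.integral_comp_add_right]
      congr 1 <;> push_cast <;> ring
    have h3 : φ * P * Real.sin φ ≤ φ ^ 2 * I := by
      have : c * Real.sin φ = 2 - 2 * Real.cos φ := by rw [hc]; field_simp
      have h4 := mul_le_mul_of_nonneg_right hint hsin0.le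
      rw [mul_right_comm c, this] at h4
      exact h4.trans (mul_le_mul_of_nonneg_right (by linarith) hI)
    have h5 : φ * P * (φ - φ ^ 3 / 4) ≤ φ ^ 2 * I := by
      have h7 : 0 ≤ φ ^ 3 := by positivity
      exact (mul_le_mul_of_nonneg_left (by linarith) (by positivity)).trans h3
    have h6 : φ ^ 2 * (P * (1 - φ ^ 2 / 4)) ≤ φ ^ 2 * I := by
      refine le_trans (le_of_eq ?_) h5; ring
    exact le_of_mul_le_mul_left h6 (by positivity)
  have hlim : Filter.Tendsto (fun m : ℕ => P * (1 - (2 * Real.pi / m) ^ 2 / 4)) Filter.atTop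
      (nhds (P * (1 - 0 ^ 2 / 4))) :=
    ((((tendsto_const_div_atTop_nhds_zero_nat (2 * Real.pi)).pow 2).div_const 4).const_sub
      1).const_mul P
  have := le_of_tendsto hlim (Filter.eventually_atTop.2 ⟨7, key⟩)
  simpa using this

end Perimeter

/-! ### Extreme points -/

section Extreme
variable {U : Set Plane}

theorem isCompact_convexJoin {s t : Set Plane} (hs : IsCompact s) (ht : IsCompact t) :
    IsCompact (convexJoin ℝ s t) := by
  have h : convexJoin ℝ s t =
      (fun p : (Plane × Plane) × ℝ => p.1.1 + p.2 • (p.1.2 - p.1.1)) '' ((s ×ˢ t) ×ˢ Icc 0 1) := by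
    ext z
    simp only [mem_convexJoin, segment_eq_image', mem_image, mem_prod, Prod.exists]
    constructor
    · rintro ⟨x, hx, y, hy, r, hr, h⟩; exact ⟨x, y, r, ⟨⟨hx, hy⟩, hr⟩, h⟩
    · rintro ⟨x, y, r, ⟨⟨hx, hy⟩, hr⟩, h⟩; exact ⟨x, hx, y, hy, r, hr, h⟩
  rw [h]
  exact ((hs.prod ht).prod isCompact_Icc).image (by fun_prop)

/-- By compactness `U` away from `e` is covered by finitely many small convex pieces missing `e`.
Joining two convex subsets of `U` keeps `e` out, since an extreme point lies on a segment in `U`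
only as an endpoint. -/
theorem exists_convex_of_mem_extremePoints (hU : IsCompact U) (hc : Convex ℝ U) {e y : Plane}
    (he : e ∈ U.extremePoints ℝ) (hy : y ∈ U) (hye : y ≠ e) {ρ : ℝ} (hρ : 0 < ρ) :
    ∃ C : Set Plane, IsCompact C ∧ Convex ℝ C ∧ C.Nonempty ∧ C ⊆ U ∧ e ∉ C ∧
      U \ Metric.ball e ρ ⊆ C := by
  refine (hU.diff Metric.isOpen_ball).induction_on (p := fun s => ∃ C : Set Plane, IsCompact C ∧
    Convex ℝ C ∧ C.Nonempty ∧ C ⊆ U ∧ e ∉ C ∧ s ⊆ C) ?_ ?_ ?_ ?_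
  · exact ⟨{y}, isCompact_singleton, convex_singleton y, singleton_nonempty y,
      singleton_subset_iff.2 hy, fun h => hye (mem_singleton_iff.1 h).symm, empty_subset _⟩
  · rintro s t hst ⟨C, h1, h2, h3, h4, h5, h6⟩
    exact ⟨C, h1, h2, h3, h4, h5, hst.trans h6⟩
  · rintro s t ⟨C, h1, h2, h3, h4, h5, h6⟩ ⟨D, k1, k2, k3, k4, k5, k6⟩
    refine ⟨convexJoin ℝ C D, isCompact_convexJoin h1 k1, h2.convexJoin k2, ?_,
      convexJoin_subset h4 k4 hc, ?_, union_subset (h6.trans (subset_convexJoin_left k3))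
        (k6.trans (subset_convexJoin_right h3))⟩
    · exact h3.mono (subset_convexJoin_left k3)
    · intro h
      obtain ⟨x, hx, z, hz, hxz⟩ := mem_convexJoin.1 h
      rcases (mem_extremePoints_iff_forall_segment.1 he).2 x (h4 hx) z (k4 hz) hxz with h | h
      · exact h5 (h ▸ hx)
      · exact k5 (h ▸ hz)
  · intro x hx
    have hxe : 0 < dist x e := hρ.trans_le (not_lt.1 fun h => hx.2 (Metric.mem_ball.2 h))
    refine ⟨U \ Metric.ball e ρ ∩ Metric.closedBall x (dist x e / 2),
      Filter.inter_mem self_mem_nhdsWithin (mem_nhdsWithin_of_mem_nhds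
        (Metric.closedBall_mem_nhds x (by linarith))),
      U ∩ Metric.closedBall x (dist x e / 2), hU.inter_right Metric.isClosed_closedBall,
      hc.inter (convex_closedBall _ _), ⟨x, hx.1, Metric.mem_closedBall_self (by linarith)⟩,
      inter_subset_left, fun h => ?_, inter_subset_inter_left _ sdiff_subset⟩
    have h1 := Metric.mem_closedBall.1 h.2
    rw [dist_comm] at h1
    linarith

theorem exists_slice (hU : IsCompact U) (hc : Convex ℝ U) {e y : Plane}
    (he : e ∈ U.extremePoints ℝ) (hy : y ∈ U) (hye : y ≠ e) {ρ : ℝ} (hρ : 0 < ρ) :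
    ∃ g > 0, ∃ α c, c + 2 * g ≤ pr α e ∧ ∀ x ∈ U, ρ ≤ ‖x - e‖ → pr α x ≤ c := by
  obtain ⟨C, h1, h2, ⟨z, hz⟩, -, h5, h6⟩ := exists_convex_of_mem_extremePoints hU hc he hy hye hρ
  obtain ⟨f, u, hfC, hfe⟩ := geometric_hahn_banach_closed_point h2 h1.isClosed h5
  obtain ⟨r, hr, α, hf⟩ := exists_eq_mul_pr f
  have hr0 : 0 < r := by
    refine hr.lt_of_ne fun h => ?_
    have := (hfC z hz).trans hfe
    rw [hf, hf, ← h] at this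
    simp at this
  rw [hf] at hfe
  refine ⟨(pr α e - u / r) / 2, ?_, α, u / r, by linarith, fun x hx hxe => ?_⟩
  · have : u / r < pr α e := by rw [div_lt_iff₀ hr0]; linarith
    linarith
  · have := hfC x (h6 ⟨hx, fun h => not_lt.2 hxe (by rw [← dist_eq_norm]; exact h)⟩)
    rw [hf] at this
    rw [le_div_iff₀ hr0]
    linarith

theorem cross_ne_zero_of_mem_extremePoints {a b c : Plane} (ha : a ∈ U.extremePoints ℝ)
    (hb : b ∈ U.extremePoints ℝ) (hc : c ∈ U.extremePoints ℝ) (hab : a ≠ b) (hac : a ≠ c)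
    (hbc : b ≠ c) : cross (b - a) (c - a) ≠ 0 := by
  intro h
  have key : ∀ {x y z : Plane} {t : ℝ}, x ∈ U.extremePoints ℝ → y ∈ U.extremePoints ℝ →
      z ∈ U.extremePoints ℝ → 0 < t → t < 1 → y = x + t • (z - x) → x = y := by
    intro x y z t hx hy hz ht ht' hyx
    refine (mem_extremePoints.1 hy).2 x hx.1 z hz.1 ?_ |>.1
    rw [openSegment_eq_image']
    exact ⟨t, ⟨ht, ht'⟩, hyx.symm⟩
  set p := b - a with hp
  have hp0 : 0 < p 0 ^ 2 + p 1 ^ 2 := by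
    rw [← norm_sq_eq]
    have := norm_pos_iff.2 (sub_ne_zero.2 hab.symm)
    positivity
  obtain ⟨r, hr⟩ : ∃ r : ℝ, c - a = r • p := by
    refine ⟨(p 0 * (c - a) 0 + p 1 * (c - a) 1) / (p 0 ^ 2 + p 1 ^ 2), ?_⟩
    rw [cross] at h
    ext i
    fin_cases i
    · change (c - a) 0 = _ * p 0
      rw [div_mul_eq_mul_div, eq_div_iff hp0.ne']
      linear_combination (-p 1) * h
    · change (c - a) 1 = _ * p 1
      rw [div_mul_eq_mul_div, eq_div_iff hp0.ne']
      linear_combination (p 0) * h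
  have hr0 : r ≠ 0 := fun h0 => hac (by rw [h0, zero_smul, sub_eq_zero] at hr; exact hr.symm)
  have hr1 : r ≠ 1 := fun h1 => hbc (by rw [h1, one_smul, hp, sub_left_inj] at hr; exact hr.symm)
  have hcb : c - b = (r - 1) • p := by
    rw [sub_smul, one_smul, ← hr, hp]; abel
  -- Of three distinct collinear points one is strictly between the others: `a`, `c` or `b`,
  -- according to the position of `r` relative to `0` and `1`.
  rcases lt_or_gt_of_ne hr0 with h1 | h1
  · refine hab.symm (key (t := 1 / (1 - r)) hb ha hc (by apply one_div_pos.2; linarith)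
      (by rw [div_lt_one (by linarith)]; linarith) ?_)
    rw [hcb, smul_smul, show 1 / (1 - r) * (r - 1) = -1 by
      rw [one_div, ← neg_sub 1 r, mul_neg, inv_mul_cancel₀ (by linarith)], neg_one_smul, hp]
    abel
  · rcases lt_or_gt_of_ne hr1 with h2 | h2
    · refine hac (key (t := r) ha hc hb h1 h2 ?_)
      rw [← hp, ← hr]; abel
    · refine hab (key (t := 1 / r) ha hb hc (by positivity)
        (by rw [div_lt_one h1]; exact h2) ?_)
      rw [hr, smul_smul, one_div, inv_mul_cancel₀ hr0, one_smul, hp]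
      abel

/-- By Krein–Milman `U` is the hull of its extreme points. They span the plane, hence include three
affinely independent ones, and there is no fourth. -/
theorem isTriangle_of_encard_extremePoints_lt (hU : IsCompact U) (hc : Convex ℝ U)
    (hint : (interior U).Nonempty) (h : (U.extremePoints ℝ).encard < 4) : IsTriangle U := by
  have hfin : (U.extremePoints ℝ).Finite := by
    rw [← encard_lt_top_iff]; exact h.trans (by decide)
  have hKM : convexHull ℝ (U.extremePoints ℝ) = U := by
    rw [← (hfin.isClosed_convexHull ℝ).closure_eq]
    exact closure_convexHull_extremePoints hU hc
  have hspan : affineSpan ℝ (U.extremePoints ℝ) = ⊤ := by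
    rw [← affineSpan_convexHull, hKM]
    exact (hc.interior_nonempty_iff_affineSpan_eq_top).1 hint
  obtain ⟨t, hts, htspan, hti⟩ := exists_affineIndependent ℝ Plane (U.extremePoints ℝ)
  have : Finite t := hfin.subset hts
  have : Fintype t := Fintype.ofFinite t
  have hcard : Fintype.card t = 3 := by
    have := hti.affineSpan_eq_top_iff_card_eq_finrank_add_one.1
      (by rw [Subtype.range_coe, htspan, hspan])
    simpa using this
  have hteq : t = U.extremePoints ℝ := by
    refine hfin.eq_of_subset_of_encard_le' hts ?_
    have h3 : t.encard = 3 := by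
      rw [encard_eq_coe_toFinset_card, toFinset_card, hcard]; rfl
    rw [h3]
    exact Order.le_of_lt_add_one (h.trans_le (by norm_num))
  let eq : Fin 3 ≃ t := (Fintype.equivFinOfCardEq hcard).symm
  refine ⟨⟨fun i => eq i, hti.comp_embedding eq.toEmbedding⟩, ?_⟩
  have hr : range (fun i => (eq i : Plane)) = U.extremePoints ℝ := by
    rw [← hteq]
    exact (eq.surjective.range_comp _).trans Subtype.range_coe
  rw [hr, hKM]

theorem exists_four_extremePoints (hU : IsCompact U) (hc : Convex ℝ U)
    (hint : (interior U).Nonempty) (h : ¬ IsTriangle U) :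
    ∃ e : Fin 4 → Plane, Function.Injective e ∧ ∀ i, e i ∈ U.extremePoints ℝ := by
  have h4 : 4 ≤ (U.extremePoints ℝ).encard :=
    not_lt.1 fun h' => h (isTriangle_of_encard_extremePoints_lt hU hc hint h')
  obtain ⟨t, hts, ht⟩ := exists_subset_encard_eq h4
  have hfin : t.Finite := finite_of_encard_eq_coe (k := 4) ht
  have : Fintype t := hfin.fintype
  have hcard : Fintype.card t = 4 := by
    rw [encard_eq_coe_toFinset_card, toFinset_card] at ht
    exact_mod_cast ht
  let eq : Fin 4 ≃ t := (Fintype.equivFinOfCardEq hcard).symm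
  exact ⟨fun i => eq i, Subtype.val_injective.comp eq.injective, fun i => hts (eq i).2⟩

end Extreme

/-! ### The gap for barriers -/

theorem exists_length_gap {U : Set Plane} (hU : IsCompact U) (hc : Convex ℝ U)
    (hint : (interior U).Nonempty) (h : ¬ IsTriangle U) :
    ∃ δ : ℝ, 0 < δ ∧ ∀ (B : Set Plane) (L : ℝ≥0), IsBarrier B U → IsRectifiableWithLength B L →
      (perimeter U).toReal / 2 + δ ≤ L := by
  obtain ⟨e, hinj, he⟩ := exists_four_extremePoints hU hc hint h
  have hslice : ∀ ρ > 0, ∃ g > 0, ∀ i, ∃ α c, c + 2 * g ≤ pr α (e i) ∧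
      ∀ x ∈ U, ρ ≤ ‖x - e i‖ → pr α x ≤ c := fun ρ hρ => by
    have hi : ∀ i, ∃ g > 0, ∃ α c, c + 2 * g ≤ pr α (e i) ∧
        ∀ x ∈ U, ρ ≤ ‖x - e i‖ → pr α x ≤ c := fun i => by
      obtain ⟨j, hj⟩ := exists_ne i
      exact exists_slice hU hc (he i) (he j).1 (hinj.ne hj) hρ
    choose g hg α c hgc hx using hi
    obtain ⟨g₀, hg₀, hle⟩ := exists_pos_forall_le hg
    exact ⟨g₀, hg₀, fun i => ⟨α i, c i, by linarith [hgc i, hle i], hx i⟩⟩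
  obtain ⟨δ, hδ, τ, hτ, σ₀, hσ₀, hgap⟩ := exists_gap hU hc (fun i => (he i).1) hinj
    (fun i j k hij hik hjk => cross_ne_zero_of_mem_extremePoints (he i) (he j) (he k)
      (hinj.ne hij) (hinj.ne hik) (hinj.ne hjk)) hslice
  -- Over two turns length counts `8` times and the perimeter at least `4` times.
  refine ⟨δ / 8, by positivity, fun B L hB hL => ?_⟩
  obtain ⟨N, a, v, σ, hσ, hσ1, hv, hN, hcov⟩ := exists_equal_segments hL hτ hσ₀
  have h1 := hgap N a v σ hσ hσ1 hv fun α => ENNReal.toReal_le_of_le_ofReal hτ.le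
    ((measure_mono (sdiff_subset_sdiff_left (hB.image_pr_subset α))).trans (hcov α))
  rw [integral_width hU (hint.mono interior_subset)] at h1
  linarith [perimeter_le_integral_supp hU hc hint]

end OpaqueSet

theorem mainTheorem2 (U : Set OpaqueSet.Plane) (p : ℝ≥0)
    (hclosed : IsClosed U) (hconvex : Convex ℝ U) (hint : (interior U).Nonempty)
    (hperimeter : OpaqueSet.perimeter U = 2 * (p : ℝ≥0∞))
    (htriangle : ¬ OpaqueSet.IsTriangle U) :
    ∃ ε : ℝ≥0, 0 < ε ∧
      ∀ (B : Set OpaqueSet.Plane) (L : ℝ≥0),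
        OpaqueSet.IsBarrier B U → OpaqueSet.IsRectifiableWithLength B L → p + ε ≤ L := by
  by_cases hb : Bornology.IsBounded U
  · obtain ⟨δ, hδ, h⟩ := OpaqueSet.exists_length_gap
      (Metric.isCompact_of_isClosed_isBounded hclosed hb) hconvex hint htriangle
    refine ⟨⟨δ, hδ.le⟩, hδ, fun B L hB hL => ?_⟩
    have := h B L hB hL
    rw [hperimeter, ENNReal.toReal_mul, ENNReal.coe_toReal, ENNReal.toReal_ofNat,
      mul_div_cancel_left₀ _ two_ne_zero] at this
    exact_mod_cast this
  -- Any positive constant works here, as there is no rectifiable barrier.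
  · exact ⟨1, one_pos, fun B L hB hL =>
      absurd hB (OpaqueSet.not_isBarrier_of_not_isBounded hconvex hb hL)⟩
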